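/- For a matroid $M$ on a finite set, write $\mathcal L(M)$ for its set of flats and, for a flat $F$, write $M_F$ for the contraction $M/F$. The characteristic polynomial $\chi_M(q)\in\mathbb Z[q]$ is determined by the conditions that $\chi_M=0$ if $M$ has a loop, and $\sum_{F\in\mathcal L(M)}\chi_{M_F}(q)=q^{\operatorname{rank}(M)}$ for every $M$. (1) Let $M$ be a matroid on a finite set, of rank $r+1$ (with $r\ge -1$). Then $$\chi_M(q)=\mu_0q^{r+1}-\mu_1q^r+\dots+(-1)^{r+1}\mu_{r+1}$$ with integers $\mu_i\ge 0$, and $\mu_{i-1}\mu_{i+1}\le\mu_i^2$ for $1\le i\le r$. (2) If moreover $r\ge 0$, then $q-1$ divides $\chi_M(q)$, and the reduced characteristic polynomial $\overline\chi_M(q)=\chi_M(q)/(q-1)$ is $$\overline\chi_M(q)=\mu^0q^{r}-\mu^1q^{r-1}+\dots+(-1)^{r}\mu^{r}$$ with integers $\mu^i\ge 0$, and $\mu^{i-1}\mu^{i+1}\le(\mu^i)^2$ for $1\le i\le r-1$. (3) For every matroid $M$ on a finite set, $\overline\chi_{M\oplus U_{1,1}}=\chi_M$, where $U_{1,1}$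 is the uniform matroid of rank $1$ on one element. (4) Let $\Gamma$ be a graph with finite vertex set $V(\Gamma)$ and finite edge set (loops and parallel edges are allowed). There is a unique polynomial $p_\Gamma\in\mathbb Z[q]$ whose value at each integer $q\ge 1$ is the number of proper colorings of $\Gamma$ with $q$ colors. With $n=|V(\Gamma)|$ it has the form $$p_\Gamma(q)=\mu_0q^{n}-\mu_1q^{n-1}+\dots+(-1)^{n}\mu_{n}$$ with integers $\mu_i\ge 0$, and $\mu_{i-1}\mu_{i+1}\le\mu_i^2$ for $1\le i\le n-1$. -/

import Mathlib

open Polynomial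

namespace Matroid

/-- The rank of a finite matroid as a natural number. -/
noncomputable def natRank {α : Type*} (M : Matroid α) : ℕ := M.eRank.toNat

open Classical in
/-- The characteristic polynomial of a finite matroid, as the solution of its defining recursion:
it vanishes if `M` has a loop, and otherwise `∑ F, charPoly (M ／ F) = X ^ rank M`, where `F` runs
over all flats of `M`, so that the term of the flat `∅` is `charPoly M` itself. The contraction
`M ／ F` is the matroid on `M.E \ F` whose flats are the sets `H \ F`, for flats `H ⊇ F` of `M`. -/
noncomputable def charPoly {α : Type*} (M : Matroid α) [M.Finite] : ℤ[X] :=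
  if M.Loopless then
    X ^ M.natRank - ∑ᶠ F : {F : Set α // M.IsFlat F ∧ F.Nonempty}, charPoly (M ／ F.1)
  else 0
termination_by M.E.ncard
decreasing_by
  have hF := F.2.1.subset_ground
  have hfin := M.ground_finite
  refine Set.ncard_lt_ncard ?_ hfin
  rw [contract_ground]
  obtain ⟨x, hx⟩ := F.2.2
  exact ⟨Set.sdiff_subset, fun h => (h (hF hx)).2 hx⟩

/-- The characteristic polynomial of a matroid with a loop is zero. -/
theorem charPoly_of_not_loopless {α : Type*} (M : Matroid α) [M.Finite] (h : ¬ M.Loopless) :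
    M.charPoly = 0 := by
  rw [charPoly, if_neg h]

/-- For a loopless matroid, the sum of the characteristic polynomials of the contractions by all
flats is `X ^ rank`. -/
theorem finsum_charPoly_of_loopless {α : Type*} (M : Matroid α) [M.Finite] (h : M.Loopless) :
    ∑ᶠ F : {F : Set α // M.IsFlat F}, (M ／ F.1).charPoly = X ^ M.natRank := by
  have hfin : Finite {F : Set α // M.IsFlat F} :=
    (M.ground_finite.finite_subsets.subset fun F hF => hF.subset_ground).to_subtype
  have hfin2 : Finite {F : Set α // M.IsFlat F ∧ F.Nonempty} :=
    (M.ground_finite.finite_subsets.subset fun F hF => hF.1.subset_ground).to_subtype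
  have h0 : M.IsFlat ∅ := by
    rw [← M.loops_eq_empty]; exact M.isFlat_closure ∅
  have hM : M.charPoly = X ^ M.natRank -
      ∑ᶠ F : {F : Set α // M.IsFlat F ∧ F.Nonempty}, (M ／ F.1).charPoly := by
    rw [charPoly, if_pos h]
  have hM2 : X ^ M.natRank = M.charPoly +
      ∑ᶠ F : {F : Set α // M.IsFlat F ∧ F.Nonempty}, (M ／ F.1).charPoly := by
    rw [hM, sub_add_cancel]
  rw [hM2, eq_comm]
  let p : Set α → ℤ[X] := fun F => (M ／ F).charPoly
  have hp0 : p ∅ = M.charPoly := by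
    have : ∀ (N : Matroid α) [N.Finite], N = M → N.charPoly = M.charPoly := by
      rintro N _ rfl; rfl
    exact this _ (contract_empty M)
  change M.charPoly + ∑ᶠ F : {F : Set α // M.IsFlat F ∧ F.Nonempty}, p F.1 =
    ∑ᶠ F : {F : Set α // M.IsFlat F}, p F.1
  have hs : {F : Set α | M.IsFlat F} = insert ∅ {F : Set α | M.IsFlat F ∧ F.Nonempty} := by
    ext F
    simp only [Set.mem_ofPred_eq, Set.mem_insert_iff]
    constructor
    · intro hF
      rcases F.eq_empty_or_nonempty with h | h
      · exact Or.inl h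
      · exact Or.inr ⟨hF, h⟩
    · rintro (rfl | hF)
      · exact h0
      · exact hF.1
  have a1 := finsum_subtype_eq_finsum_cond (f := p) (fun F => M.IsFlat F)
  have a2 := finsum_subtype_eq_finsum_cond (f := p) (fun F => M.IsFlat F ∧ F.Nonempty)
  rw [a1, a2, ← hp0]
  have := finsum_mem_insert p (a := ∅) (s := {F : Set α | M.IsFlat F ∧ F.Nonempty}) (by simp)
    (M.ground_finite.finite_subsets.subset fun F hF => hF.1.subset_ground)
  rw [← hs] at this
  exact this.symm

/-- For every finite matroid, possibly with loops, the sum of the characteristic polynomials of the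
contractions by all flats is `X ^ rank`. -/
theorem finsum_charPoly {α : Type*} (M : Matroid α) [M.Finite] :
    ∑ᶠ F : {F : Set α // M.IsFlat F}, (M ／ F.1).charPoly = X ^ M.natRank := by
  have hl : (M ／ M.loops).Loopless := by
    refine ⟨?_⟩
    rw [contract_loops_eq, loops, closure_closure, Set.sdiff_self]
  have hr : (M ／ M.loops).natRank = M.natRank := by
    have : (M ／ M.loops).eRank = M.eRank := by
      rw [contract_eq_delete_of_subset_loops subset_rfl, delete_eq_restrict, eRank_restrict,
        eRk_eq_eRk_sdiff_eRk_le_zero _ (by rw [eRk_loops]), eRk_ground]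
    rw [natRank, natRank, this]
  rw [← hr, ← finsum_charPoly_of_loopless _ hl]
  have hcl : ∀ F, M.IsFlat F → M.loops ⊆ F := fun F hF => hF.loops_subset
  have hto : ∀ F, M.IsFlat F → (M ／ M.loops).IsFlat (F \ M.loops) := by
    intro F hF
    rw [isFlat_iff_closure_eq, contract_closure_eq, Set.sdiff_union_of_subset (hcl F hF),
      hF.closure]
  have hfrom : ∀ F, (M ／ M.loops).IsFlat F → M.IsFlat (F ∪ M.loops) := by
    intro F hF
    have h1 := hF.closure
    rw [contract_closure_eq] at h1
    rw [isFlat_iff_closure_eq]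
    conv_rhs => rw [← h1]
    rw [Set.sdiff_union_of_subset (hcl _ (M.isFlat_closure _))]
  refine finsum_eq_of_bijective
    (fun F : {F : Set α // M.IsFlat F} => ⟨F.1 \ M.loops, hto F.1 F.2⟩) ⟨?_, ?_⟩ ?_
  · rintro ⟨F, hF⟩ ⟨G, hG⟩ h
    have h : F \ M.loops = G \ M.loops := congrArg Subtype.val h
    refine Subtype.ext ?_
    change F = G
    rw [← Set.sdiff_union_of_subset (hcl F hF), h, Set.sdiff_union_of_subset (hcl G hG)]
  · rintro ⟨F, hF⟩
    refine ⟨⟨F ∪ M.loops, hfrom F hF⟩, Subtype.ext ?_⟩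
    have hd : Disjoint F M.loops := (Set.subset_sdiff.1 hF.subset_ground).2
    simpa using hd
  · rintro ⟨F, hF⟩
    have key : ∀ (N N' : Matroid α) [N.Finite] [N'.Finite], N = N' → N.charPoly = N'.charPoly := by
      rintro N N' _ _ rfl; rfl
    refine key _ _ ?_
    change M ／ F = M ／ M.loops ／ (F \ M.loops)
    rw [contract_contract, Set.union_sdiff_cancel (hcl F hF)]

/-- The reduced characteristic polynomial: the quotient of the characteristic polynomial by
`X - 1` (which is an exact quotient as soon as the rank is positive). -/
noncomputable def reducedCharPoly {α : Type*} (M : Matroid α) [M.Finite] : ℤ[X] :=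
  M.charPoly /ₘ (X - C 1)

/-- The uniform matroid of rank one on one element. -/
def uniformOneOne : Matroid Unit := freeOn Set.univ

/-- A direct sum of finite matroids is finite. -/
instance sum_finite {α β : Type*} (M : Matroid α) (N : Matroid β) [M.Finite] [N.Finite] :
    (M.sum N).Finite := by
  refine ⟨?_⟩
  rw [Matroid.sum_ground]
  exact (M.ground_finite.image _).union (N.ground_finite.image _)

instance uniformOneOne_finite : uniformOneOne.Finite := ⟨Set.toFinite _⟩

end Matroid

/-- The coefficient sequence `a` of a polynomial written with alternating signs in the form
`p = a 0 * X ^ d - a 1 * X ^ (d - 1) + ⋯ + (-1) ^ d * a d` (meaningful for indices `i ≤ d`). -/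
noncomputable def alternatingCoeff (p : ℤ[X]) (d i : ℕ) : ℤ := (-1) ^ i * p.coeff (d - i)

/-- A polynomial `p` can be written `p = a 0 * X ^ d - a 1 * X ^ (d - 1) + ⋯ + (-1) ^ d * a d`
with nonnegative integers `a 0, …, a d` that form a log-concave sequence. -/
def HasLogConcaveAlternatingCoeffs (p : ℤ[X]) (d : ℕ) : Prop :=
  p.natDegree ≤ d ∧
  (∀ i, i ≤ d → 0 ≤ alternatingCoeff p d i) ∧
  ∀ i, 1 ≤ i → i + 1 ≤ d →
    alternatingCoeff p d (i - 1) * alternatingCoeff p d (i + 1) ≤ alternatingCoeff p d i ^ 2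

namespace Graph

/-- The number of proper colorings of the multigraph `G` with `q` colors: the two ends of every
edge have different colors (so that there is none if `G` has a loop). -/
noncomputable def numProperColorings {V E : Type*} (G : Graph V E) (q : ℕ) : ℕ :=
  Nat.card {c : G.vertexSet → Fin q // ∀ (e : E) (x y : G.vertexSet), G.IsLink e x y → c x ≠ c y}

/-- `p` is the chromatic polynomial of `G`: for every positive integer `q`, its value at `q` is
the number of proper colorings of `G` with `q` colors. -/
def IsChromaticPolynomial {V E : Type*} (G : Graph V E) (p : ℤ[X]) : Prop :=
  ∀ q : ℕ, 1 ≤ q → p.eval (q : ℤ) = (G.numProperColorings q : ℤ)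

end Graph

/-! Let `M` be loopless and let w(F) = |μ(∅, F)| on its flats. Then χ_M(q) = ∑ μ(∅, F) q^(rk M − rk
F). Fix a point i. By Weisner's theorem, μ(∅, F) for F ∋ i is minus the sum of μ(∅, P) over the P ∌
i with cl(P ∪ i) = F. So χ_M is divisible by q − 1, and the reduced coefficients are a_k, the sum of
w over the flats of rank k avoiding i (`charPoly_eq_mul_avoidingPoly`, `coeff_avoidingPoly`).

Log-concavity of a_k is a reverse Cauchy–Schwarz inequality (`FlatInequality`). On functions Y, Z on
the flats of ranks k and k + 1 inside a flat G ∋ i, put Q(Y, Z) = ∑ w_F Y_F² + ∑ w_H Z_H² − ∑_{F ⊂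
H} w_F (Y_F − Z_H)². Then (∑_{H ∌ i} w_H) Q(Y, Z) ≤ (∑ w_H Z_H)². In ranks k + 1, k + 2 of the whole
matroid, with Y and Z the indicator of containing i, this reads a_{k+2} a_k ≤ a_{k+1}².

The inequality is proved by induction on k, using three consecutive ranks P, F, H and the form A =
upper + s · lower with 0 < s < 1. At a positive vector h, interpolating between 1 and the indicator
of avoiding i, A h = d is positive and explicit. Euler's formula (`sum_deriv`) writes the form as ∑
h_v q_v with q_v quadratic. Each q_v is bounded by a multiple of (A x)_v²: through a sum of squares
at P, arithmetic–geometric mean at F, and the induction hypothesis at H. Hence ⟨x, A x⟩ ≤ ∑ h_v (A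
x)_v² / d_v. This forces every eigenvalue l of the normalized matrix to satisfy l ≤ l². As l ≤ 1 as
well, with l = 1 only along h because the incidence graph is connected, A is negative semidefinite
on the complement of d. Letting s → 0 gives the inequality for the upper two ranks.

Adding a coloop turns χ_M into a reduced characteristic polynomial, so the full coefficients are
log-concave too. For graphs, sorting colorings by their flat of monochromatic edges and applying
Möbius inversion gives p_Γ = q^(n − rk) χ of the graphic matroid. -/

/-! ### Spectral criterion for a reverse Cauchy–Schwarz inequality -/

/-- A symmetric real matrix with nonnegative off-diagonal entries and positive row sums `d`, whose
graph is connected and which satisfies `⟪y, A y⟫ ≤ ∑ v, (A y)_v ^ 2 / d_v`, is negative semidefinite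
on the vectors orthogonal to its row sums. -/
theorem Matrix.quadratic_nonpos_of_rowSum {V : Type*} [Fintype V] [DecidableEq V]
    (A : V → V → ℝ) (d : V → ℝ) (hsymm : ∀ u v, A u v = A v u)
    (hoff : ∀ u v, u ≠ v → 0 ≤ A u v) (hd : ∀ v, 0 < d v) (hrow : ∀ u, ∑ v, A u v = d u)
    (hconn : ∀ g : V → ℝ, (∀ u v, u ≠ v → 0 < A u v → g u = g v) → ∀ u v, g u = g v)
    (hK : ∀ y : V → ℝ, ∑ u, ∑ v, A u v * y u * y v ≤ ∑ u, (∑ v, A u v * y v) ^ 2 / d u)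
    (y : V → ℝ) (hy : ∑ v, d v * y v = 0) :
    ∑ u, ∑ v, A u v * y u * y v ≤ 0 := by
  let r : V → ℝ := fun v => Real.sqrt (d v)
  have hr : ∀ v, 0 < r v := fun v => Real.sqrt_pos.2 (hd v)
  have hrr : ∀ v, r v * r v = d v := fun v => Real.mul_self_sqrt (hd v).le
  -- The symmetric normalization of `A` by its row sums; `r` is an eigenvector of `B` with
  -- eigenvalue 1.
  let B : Matrix V V ℝ := Matrix.of fun u v => A u v / (r u * r v)
  have hB : B.IsHermitian := by
    ext u v
    simp [B, hsymm u v, mul_comm]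
  let e := hB.eigenvectorBasis
  -- `hK` at the rescaled eigenvector gives `l ≤ l ^ 2`, and nonnegativity of the Dirichlet energy
  -- gives `l ≤ 1`. So a positive eigenvalue is 1, the energy vanishes, and connectedness makes the
  -- eigenvector proportional to `r`.
  have key : ∀ j, hB.eigenvalues j ≤ 0 ∨ (∀ u v, (e j) u / r u = (e j) v / r v) := by
    intro j
    set l := hB.eigenvalues j with hl
    have hev : ∀ u, ∑ v, B u v * e j v = l * e j u := by
      intro u
      have := congrFun (hB.mulVec_eigenvectorBasis j) u
      simpa [Matrix.mulVec, dotProduct] using this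
    have hev' : ∀ u, ∑ v, A u v * (e j v / r v) = l * r u * e j u := by
      intro u
      have h1 : ∑ v, A u v * (e j v / r v) = r u * ∑ v, B u v * e j v := by
        rw [Finset.mul_sum]
        refine Finset.sum_congr rfl fun v _ => ?_
        have := (hr u).ne'
        have := (hr v).ne'
        simp only [B, Matrix.of_apply]
        field_simp
      rw [h1, hev u]; ring
    have hnorm : ∑ u, e j u ^ 2 = 1 := by
      have h1 : ‖e j‖ = 1 := e.orthonormal.1 j
      have h2 := EuclideanSpace.norm_sq_eq (e j)
      rw [h1] at h2
      simpa using h2.symm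
    have hquad : ∑ u, ∑ v, A u v * (e j u / r u) * (e j v / r v) = l := by
      have : ∀ u, ∑ v, A u v * (e j u / r u) * (e j v / r v) = l * e j u ^ 2 := by
        intro u
        have h1 : ∑ v, A u v * (e j u / r u) * (e j v / r v)
            = (e j u / r u) * ∑ v, A u v * (e j v / r v) := by
          rw [Finset.mul_sum]
          exact Finset.sum_congr rfl fun v _ => by ring
        rw [h1, hev' u]
        have := (hr u).ne'
        field_simp
      rw [Finset.sum_congr rfl fun u _ => this u, ← Finset.mul_sum, hnorm, mul_one]
    have hl2 : l ≤ l ^ 2 := by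
      have h1 := hK (fun v => e j v / r v)
      rw [hquad] at h1
      have h2 : ∑ u, (∑ v, A u v * (e j v / r v)) ^ 2 / d u = l ^ 2 := by
        have : ∀ u, (∑ v, A u v * (e j v / r v)) ^ 2 / d u = l ^ 2 * e j u ^ 2 := by
          intro u
          rw [hev' u, ← hrr u]
          have := (hr u).ne'
          field_simp
        rw [Finset.sum_congr rfl fun u _ => this u, ← Finset.mul_sum, hnorm, mul_one]
      rwa [h2] at h1
    have hdir : ∑ u, ∑ v, A u v * (e j u / r u - e j v / r v) ^ 2 = 2 - 2 * l := by
      have hsq : ∀ u, d u * (e j u / r u) ^ 2 = e j u ^ 2 := by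
        intro u
        rw [← hrr u]
        have := (hr u).ne'
        field_simp
      have h1 : ∑ u, ∑ v, A u v * (e j u / r u) ^ 2 = 1 := by
        rw [← hnorm]
        refine Finset.sum_congr rfl fun u _ => ?_
        rw [← Finset.sum_mul, hrow u, hsq u]
      have h2 : ∑ u, ∑ v, A u v * (e j v / r v) ^ 2 = 1 := by
        rw [Finset.sum_comm, ← hnorm]
        refine Finset.sum_congr rfl fun u _ => ?_
        rw [← Finset.sum_mul, Finset.sum_congr rfl fun v _ => hsymm v u, hrow u, hsq u]
      have h3 : ∑ u, ∑ v, A u v * (e j u / r u - e j v / r v) ^ 2 =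
          ∑ u, ∑ v, A u v * (e j u / r u) ^ 2 + ∑ u, ∑ v, A u v * (e j v / r v) ^ 2
          - 2 * ∑ u, ∑ v, A u v * (e j u / r u) * (e j v / r v) := by
        simp only [Finset.mul_sum, ← Finset.sum_add_distrib, ← Finset.sum_sub_distrib]
        exact Finset.sum_congr rfl fun u _ => Finset.sum_congr rfl fun v _ => by ring
      rw [h3, h1, h2, hquad]; ring
    -- The diagonal entries of `A` may be negative, but they multiply a zero difference.
    have hnn : ∀ u v, 0 ≤ A u v * (e j u / r u - e j v / r v) ^ 2 := by
      intro u v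
      rcases eq_or_ne u v with rfl | huv
      · simp
      · exact mul_nonneg (hoff u v huv) (sq_nonneg _)
    have hl1 : l ≤ 1 := by
      have : 0 ≤ ∑ u, ∑ v, A u v * (e j u / r u - e j v / r v) ^ 2 :=
        Finset.sum_nonneg fun u _ => Finset.sum_nonneg fun v _ => hnn u v
      linarith
    by_cases h0 : l ≤ 0
    · exact Or.inl h0
    right
    have hl1' : l = 1 := by nlinarith
    rw [hl1'] at hdir
    norm_num at hdir
    rw [Finset.sum_eq_zero_iff_of_nonneg
      (fun u _ => Finset.sum_nonneg fun v _ => hnn u v)] at hdir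
    refine hconn (fun u => e j u / r u) fun u v _ hA => ?_
    have h1 := hdir u (Finset.mem_univ _)
    rw [Finset.sum_eq_zero_iff_of_nonneg (fun v _ => hnn u v)] at h1
    have h2 := h1 v (Finset.mem_univ _)
    rcases mul_eq_zero.1 h2 with h | h
    · exact absurd h hA.ne'
    · have := pow_eq_zero_iff (two_ne_zero) |>.1 h
      linarith
  let z : EuclideanSpace ℝ V := WithLp.toLp 2 fun v => r v * y v
  have hzval : ∀ v, z v = r v * y v := fun v => rfl
  have hexp : ∑ u, ∑ v, A u v * y u * y v = ∑ j, hB.eigenvalues j * (inner ℝ (e j) z) ^ 2 := by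
    have h1 : ∑ u, ∑ v, A u v * y u * y v
        = inner ℝ z (WithLp.toLp 2 (B.mulVec z.ofLp) : EuclideanSpace ℝ V) := by
      simp only [PiLp.inner_apply, RCLike.inner_apply, conj_trivial, Matrix.mulVec, dotProduct,
        Finset.sum_mul]
      refine Finset.sum_congr rfl fun u _ => Finset.sum_congr rfl fun v _ => ?_
      have := (hr u).ne'
      have := (hr v).ne'
      simp only [hzval, B, Matrix.of_apply]
      field_simp
    have h2 : ∀ j, inner ℝ (e j) (WithLp.toLp 2 (B.mulVec z.ofLp) : EuclideanSpace ℝ V)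
        = hB.eigenvalues j * inner ℝ (e j) z := by
      intro j
      have hev : ∀ u, ∑ v, B u v * e j v = hB.eigenvalues j * e j u := by
        intro u
        have := congrFun (hB.mulVec_eigenvectorBasis j) u
        simpa [Matrix.mulVec, dotProduct] using this
      simp only [PiLp.inner_apply, RCLike.inner_apply, conj_trivial, Matrix.mulVec, dotProduct,
        Finset.sum_mul]
      rw [Finset.sum_comm, Finset.mul_sum]
      refine Finset.sum_congr rfl fun v _ => ?_
      have hBs : ∀ u, B u v = B v u := fun u => by simp [B, hsymm u v, mul_comm]
      calc ∑ u, B u v * z v * e j u = z v * ∑ u, B v u * e j u := by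
            rw [Finset.mul_sum]
            exact Finset.sum_congr rfl fun u _ => by rw [hBs u]; ring
        _ = _ := by rw [hev v]; ring
    rw [h1, ← e.sum_inner_mul_inner]
    refine Finset.sum_congr rfl fun j _ => ?_
    rw [h2 j, real_inner_comm]
    ring
  rw [hexp]
  refine Finset.sum_nonpos fun j _ => ?_
  rcases key j with h | h
  · exact mul_nonpos_of_nonpos_of_nonneg h (sq_nonneg _)
  · have : inner ℝ (e j) z = 0 := by
      simp only [PiLp.inner_apply, RCLike.inner_apply, conj_trivial, hzval]
      rcases isEmpty_or_nonempty V with hV | ⟨⟨v0⟩⟩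
      · simp
      have h1 : ∀ v, r v * y v * e j v = (e j v0 / r v0) * (d v * y v) := by
        intro v
        rw [← h v v0, ← hrr v]
        have := (hr v).ne'
        field_simp
      rw [Finset.sum_congr rfl fun v _ => h1 v, ← Finset.mul_sum, hy, mul_zero]
    rw [this]; simp

/-- A symmetric real matrix `A` with nonnegative off-diagonal entries and connected graph, together
with a positive vector `h` such that `A h` is positive and
`⟪x, A x⟫ ≤ ∑ v, h_v (A x)_v ^ 2 / (A h)_v`, satisfies the reverse Cauchy–Schwarz inequality
with respect to `h`. -/
theorem Matrix.reverse_cauchySchwarz {V : Type*} [Fintype V] [DecidableEq V]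
    (A : V → V → ℝ) (h d : V → ℝ) (hsymm : ∀ u v, A u v = A v u)
    (hoff : ∀ u v, u ≠ v → 0 ≤ A u v) (hh : ∀ v, 0 < h v) (hd : ∀ v, 0 < d v)
    (hrow : ∀ u, ∑ v, A u v * h v = d u)
    (hconn : ∀ g : V → ℝ, (∀ u v, u ≠ v → 0 < A u v → g u = g v) → ∀ u v, g u = g v)
    (hK : ∀ x : V → ℝ, ∑ u, x u * ∑ v, A u v * x v ≤ ∑ u, h u * (∑ v, A u v * x v) ^ 2 / d u)
    (x : V → ℝ) :
    (∑ u, x u * ∑ v, A u v * x v) * (∑ v, d v * h v) ≤ (∑ v, d v * x v) ^ 2 := by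
  rcases isEmpty_or_nonempty V with hV | hV
  · simp
  have hneg : ∀ x : V → ℝ, ∑ v, d v * x v = 0 → ∑ u, x u * ∑ v, A u v * x v ≤ 0 := by
    intro x hx
    have hne : ∀ v, h v ≠ 0 := fun v => (hh v).ne'
    -- Substituting x = h y turns `A h = d` into a statement about row sums, now equal to `h v * d
    -- v`.
    have := Matrix.quadratic_nonpos_of_rowSum (fun u v => h u * A u v * h v)
      (fun v => h v * d v) (fun u v => by rw [hsymm u v]; ring)
      (fun u v huv => mul_nonneg (mul_nonneg (hh u).le (hoff u v huv)) (hh v).le)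
      (fun v => mul_pos (hh v) (hd v))
      (fun u => by
        rw [← hrow u, Finset.mul_sum]
        exact Finset.sum_congr rfl fun v _ => by ring)
      (fun g hg => hconn g fun u v huv hA => hg u v huv
        (mul_pos (mul_pos (hh u) hA) (hh v)))
      (fun y => by
        have h1 := hK fun v => h v * y v
        refine le_trans (le_of_eq ?_) (h1.trans (le_of_eq ?_))
        · refine Finset.sum_congr rfl fun u _ => ?_
          rw [Finset.mul_sum]
          exact Finset.sum_congr rfl fun v _ => by ring
        · refine Finset.sum_congr rfl fun u _ => ?_
          have h2 : ∑ v, h u * A u v * h v * y v = h u * ∑ v, A u v * (h v * y v) := by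
            rw [Finset.mul_sum]
            exact Finset.sum_congr rfl fun v _ => by ring
          rw [h2]
          have := hne u
          have := (hd u).ne'
          field_simp)
      (fun v => x v / h v) (by
        rw [← hx]
        refine Finset.sum_congr rfl fun v _ => ?_
        have := hne v
        field_simp)
    refine le_trans (le_of_eq ?_) this
    refine Finset.sum_congr rfl fun u _ => ?_
    rw [Finset.mul_sum]
    refine Finset.sum_congr rfl fun v _ => ?_
    have := hne u
    have := hne v
    field_simp
  set W := ∑ v, d v * h v with hW
  have hWpos : 0 < W := Finset.sum_pos (fun v _ => mul_pos (hd v) (hh v)) Finset.univ_nonempty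
  set L := ∑ v, d v * x v with hL
  have hself : ∀ x : V → ℝ, ∑ u, h u * ∑ v, A u v * x v = ∑ v, d v * x v := by
    intro x
    simp only [Finset.mul_sum]
    rw [Finset.sum_comm]
    refine Finset.sum_congr rfl fun v _ => ?_
    rw [← hrow v, Finset.sum_mul]
    exact Finset.sum_congr rfl fun u _ => by rw [hsymm u v]; ring
  -- This is W times the projection of `x` along `h` onto the kernel of `d`. Since `A h = d`, the
  -- form takes the value W (W ⟨x, A x⟩ − L²) there, and W > 0.
  have h1 := hneg (fun v => W * x v - L * h v) (by
    simp only [mul_sub, Finset.sum_sub_distrib]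
    have e1 : ∑ v, d v * (W * x v) = W * L := by
      rw [hL, Finset.mul_sum]; exact Finset.sum_congr rfl fun v _ => by ring
    have e2 : ∑ v, d v * (L * h v) = L * W := by
      rw [hW, Finset.mul_sum]; exact Finset.sum_congr rfl fun v _ => by ring
    rw [e1, e2]; ring)
  have h2 : ∀ u, ∑ v, A u v * (W * x v - L * h v) = W * ∑ v, A u v * x v - L * d u := by
    intro u
    rw [← hrow u, Finset.mul_sum, Finset.mul_sum, ← Finset.sum_sub_distrib]
    exact Finset.sum_congr rfl fun v _ => by ring
  have h3 : ∑ u, (W * x u - L * h u) * ∑ v, A u v * (W * x v - L * h v)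
      = W * (W * (∑ u, x u * ∑ v, A u v * x v) - L ^ 2) := by
    have e1 : ∀ u, (W * x u - L * h u) * ∑ v, A u v * (W * x v - L * h v)
        = W ^ 2 * (x u * ∑ v, A u v * x v) - W * L * (d u * x u)
          - W * L * (h u * ∑ v, A u v * x v) + L ^ 2 * (d u * h u) := by
      intro u; rw [h2 u]; ring
    rw [Finset.sum_congr rfl fun u _ => e1 u]
    simp only [Finset.sum_add_distrib, Finset.sum_sub_distrib, ← Finset.mul_sum]
    rw [hself x, ← hW, ← hL]; ring
  rw [h3] at h1
  nlinarith

/-! ### Quadratic forms on three consecutive levels -/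

/-- Three consecutive levels `P`, `F`, `H` of a ranked poset with positive weights: `a`, `b`, `c`
are the incidence matrices, and `p`, `f`, `h` are the indicator functions of not containing a fixed
point `i`. The axioms hold for the flats of ranks `k - 1`, `k`, `k + 1` of a loopless matroid, with
weights the absolute values of the Möbius function. -/
structure WeightedLevels (P F H : Type*) [Fintype P] [Fintype F] [Fintype H] where
  a : P → F → ℝ
  b : F → H → ℝ
  c : P → H → ℝ
  wP : P → ℝ
  wF : F → ℝ
  wH : H → ℝ
  p : P → ℝ
  f : F → ℝ
  h : H → ℝ
  a_mul_self : ∀ x y, a x y * a x y = a x y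
  b_mul_self : ∀ y z, b y z * b y z = b y z
  c_nonneg : ∀ x z, 0 ≤ c x z
  a_mul_b_mul_c : ∀ x y z, a x y * b y z * c x z = a x y * b y z
  wP_pos : ∀ x, 0 < wP x
  wF_pos : ∀ y, 0 < wF y
  wH_pos : ∀ z, 0 < wH z
  p_mem : ∀ x, 0 ≤ p x ∧ p x ≤ 1
  f_mem : ∀ y, 0 ≤ f y ∧ f y ≤ 1
  h_mem : ∀ z, 0 ≤ h z ∧ h z ≤ 1
  sum_a : ∀ x, ∑ y, a x y * (p x - f y) = p x
  sum_b : ∀ y, ∑ z, b y z * (f y - h z) = f y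
  sum_wP : ∀ y, ∑ x, a x y * wP x * (p x - f y) = (1 - f y) * wF y
  sum_wF : ∀ z, ∑ y, b y z * wF y * (f y - h z) = (1 - h z) * wH z
  sum_a_b : ∀ x z, ∑ y, a x y * b y z * (p x - f y) = c x z * (p x - h z)
  sum_b_b : ∀ x y y', y ≠ y' → a x y * a x y' * ∑ z, b y z * b y' z = a x y * a x y'
  connected : ∀ (gP : P → ℝ) (gF : F → ℝ) (gH : H → ℝ),
    (∀ x y, a x y = 1 → gP x = gF y) → (∀ y z, b y z = 1 → gF y = gH z) →
    ∃ t, (∀ x, gP x = t) ∧ (∀ y, gF y = t) ∧ ∀ z, gH z = t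
  local_ineq : ∀ (z : H) (X : P → ℝ) (Y : F → ℝ),
    wH z * (∑ x, c x z * wP x * X x ^ 2 + ∑ y, b y z * wF y * Y y ^ 2
      - ∑ x, ∑ y, a x y * b y z * wP x * (X x - Y y) ^ 2) ≤ (∑ y, b y z * wF y * Y y) ^ 2

namespace WeightedLevels

variable {P F H : Type*} [Fintype P] [Fintype F] [Fintype H] (D : WeightedLevels P F H)
  (X : P → ℝ) (Y : F → ℝ) (Z : H → ℝ)

/-- The quadratic form of the two upper levels. -/
noncomputable def upperForm : ℝ :=
  ∑ y, D.wF y * Y y ^ 2 + ∑ z, D.wH z * Z z ^ 2 - ∑ y, ∑ z, D.b y z * D.wF y * (Y y - Z z) ^ 2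

/-- The quadratic form of the two lower levels. -/
noncomputable def lowerForm : ℝ :=
  ∑ x, D.wP x * X x ^ 2 + ∑ y, D.wF y * Y y ^ 2 - ∑ x, ∑ y, D.a x y * D.wP x * (X x - Y y) ^ 2

noncomputable def linP (x : P) : ℝ := X x + ∑ y, D.a x y * (Y y - X x)

noncomputable def linFDown (y : F) : ℝ := ∑ x, D.a x y * D.wP x * (X x - Y y) + D.wF y * Y y

noncomputable def linFUp (y : F) : ℝ := ∑ z, D.b y z * (Z z - Y y) + Y y

noncomputable def linH (z : H) : ℝ := ∑ y, D.b y z * D.wF y * (Y y - Z z) + D.wH z * Z z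

/-- The derivative of the cubic form in the direction of an element of the lower level. -/
noncomputable def derivP (x : P) : ℝ :=
  X x ^ 2 + ∑ y, D.a x y * (Y y ^ 2 - X x ^ 2) - ∑ y, ∑ z, D.a x y * D.b y z * (Y y - Z z) ^ 2
    + ∑ z, (∑ y, D.a x y * D.b y z - D.c x z) * (Z z - X x) ^ 2

/-- The derivative of the cubic form in the direction of an element of the upper level. -/
noncomputable def derivH (z : H) : ℝ :=
  ∑ x, D.c x z * D.wP x * (X x - Z z) ^ 2 + ∑ y, D.b y z * D.wF y * (Y y ^ 2 - Z z ^ 2)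
    - ∑ x, ∑ y, D.a x y * D.b y z * D.wP x * (X x - Y y) ^ 2 + D.wH z * Z z ^ 2

/-- Apply `local_ineq` to the values translated by `Z z`. The translation adds 2 Z S + w Z² to the
form, which after multiplication by w completes S² to the square of S + w Z. -/
theorem derivH_le (z : H) : D.wH z * D.derivH X Y Z z ≤ D.linH Y Z z ^ 2 := by
  have h1 := D.local_ineq z (fun x => X x - Z z) (fun y => Y y - Z z)
  set S := ∑ y, D.b y z * D.wF y * (Y y - Z z) with hS
  have h2 : D.derivH X Y Z z = (∑ x, D.c x z * D.wP x * (X x - Z z) ^ 2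
      + ∑ y, D.b y z * D.wF y * (Y y - Z z) ^ 2
      - ∑ x, ∑ y, D.a x y * D.b y z * D.wP x * (X x - Z z - (Y y - Z z)) ^ 2)
      + 2 * Z z * S + D.wH z * Z z ^ 2 := by
    have e1 : ∑ y, D.b y z * D.wF y * (Y y ^ 2 - Z z ^ 2)
        = ∑ y, D.b y z * D.wF y * (Y y - Z z) ^ 2 + 2 * Z z * S := by
      rw [hS, Finset.mul_sum, ← Finset.sum_add_distrib]
      exact Finset.sum_congr rfl fun y _ => by ring
    have e2 : ∑ x, ∑ y, D.a x y * D.b y z * D.wP x * (X x - Z z - (Y y - Z z)) ^ 2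
        = ∑ x, ∑ y, D.a x y * D.b y z * D.wP x * (X x - Y y) ^ 2 := by
      exact Finset.sum_congr rfl fun x _ => Finset.sum_congr rfl fun y _ => by ring
    rw [derivH, e1, e2]; ring
  rw [h2, linH, ← hS]
  nlinarith

/-- The difference of the two sides is a sum of squares over the levels above `x`, with weights `c x
z`. The identity rests on `sum_b_b`: two distinct covers of `x` have exactly one common cover, so
the mixed products in (∑ u)² are each counted once. -/
theorem derivP_le (x : P) : D.derivP X Y Z x ≤ D.linP X Y x ^ 2 := by
  classical
  set u : F → ℝ := fun y => D.a x y * (Y y - X x) with hu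
  have hau : ∀ y, D.a x y * u y = u y := fun y => by
    rw [hu]; dsimp only; rw [← mul_assoc, D.a_mul_self]
  have hsq : ∑ z, D.c x z * (∑ y, D.b y z * u y) ^ 2
      = (∑ y, u y) ^ 2 + ∑ y, ∑ z, D.b y z * u y ^ 2 - ∑ y, u y ^ 2 := by
    have e1 : ∀ z, D.c x z * (∑ y, D.b y z * u y) ^ 2
        = ∑ y, ∑ y', D.b y z * D.b y' z * (u y * u y') := by
      intro z
      rw [sq, Finset.sum_mul_sum, Finset.mul_sum]
      refine Finset.sum_congr rfl fun y _ => ?_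
      rw [Finset.mul_sum]
      refine Finset.sum_congr rfl fun y' _ => ?_
      have := D.a_mul_b_mul_c x y z
      rw [← hau y]
      linear_combination (u y * D.b y' z * u y') * this
    rw [Finset.sum_congr rfl fun z _ => e1 z, Finset.sum_comm]
    have e2 : ∀ y, ∑ z, ∑ y', D.b y z * D.b y' z * (u y * u y')
        = u y * (∑ y', u y') + ∑ z, D.b y z * u y ^ 2 - u y ^ 2 := by
      intro y
      rw [Finset.sum_comm]
      have e3 : ∀ y', ∑ z, D.b y z * D.b y' z * (u y * u y')
          = u y * u y' + if y = y' then ∑ z, D.b y z * u y ^ 2 - u y ^ 2 else 0 := by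
        intro y'
        split_ifs with hyy
        · subst hyy
          rw [add_sub, ← sq, add_sub_cancel_left]
          exact Finset.sum_congr rfl fun z _ => by rw [D.b_mul_self]
        · rw [← Finset.sum_mul]
          have := D.sum_b_b x y y' hyy
          rw [← hau y, ← hau y']
          linear_combination (u y * u y') * this
      rw [Finset.sum_congr rfl fun y' _ => e3 y', Finset.sum_add_distrib, ← Finset.mul_sum,
        Finset.sum_ite_eq, if_pos (Finset.mem_univ _)]
      ring
    rw [Finset.sum_congr rfl fun y _ => e2 y, Finset.sum_sub_distrib, Finset.sum_add_distrib,
      ← Finset.sum_mul]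
    ring
  have hid : D.derivP X Y Z x = D.linP X Y x ^ 2
      - ∑ z, D.c x z * (Z z - X x - ∑ y, D.b y z * u y) ^ 2 := by
    have e1 : ∑ z, D.c x z * (Z z - X x - ∑ y, D.b y z * u y) ^ 2
        = ∑ z, D.c x z * (Z z - X x) ^ 2 - ∑ y, ∑ z, 2 * D.b y z * u y * (Z z - X x)
          + ∑ z, D.c x z * (∑ y, D.b y z * u y) ^ 2 := by
      rw [Finset.sum_comm, ← Finset.sum_sub_distrib, ← Finset.sum_add_distrib]
      refine Finset.sum_congr rfl fun z _ => ?_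
      have : ∑ y, 2 * D.b y z * u y * (Z z - X x)
          = 2 * D.c x z * (Z z - X x) * ∑ y, D.b y z * u y := by
        rw [Finset.mul_sum]
        refine Finset.sum_congr rfl fun y _ => ?_
        have := D.a_mul_b_mul_c x y z
        rw [← hau y]
        linear_combination (-2 * u y * (Z z - X x)) * this
      rw [this]; ring
    have e2 : ∑ y, ∑ z, D.a x y * D.b y z * (Y y - Z z) ^ 2
        = ∑ z, (∑ y, D.a x y * D.b y z) * (Z z - X x) ^ 2 + ∑ y, ∑ z, D.b y z * u y ^ 2
          - ∑ y, ∑ z, 2 * D.b y z * u y * (Z z - X x) := by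
      have : ∑ z, (∑ y, D.a x y * D.b y z) * (Z z - X x) ^ 2
          = ∑ y, ∑ z, D.a x y * D.b y z * (Z z - X x) ^ 2 := by
        rw [Finset.sum_comm]
        exact Finset.sum_congr rfl fun z _ => by rw [Finset.sum_mul]
      rw [this, ← Finset.sum_add_distrib, ← Finset.sum_sub_distrib]
      refine Finset.sum_congr rfl fun y _ => ?_
      rw [← Finset.sum_add_distrib, ← Finset.sum_sub_distrib]
      refine Finset.sum_congr rfl fun z _ => ?_
      have := D.a_mul_self x y
      simp only [hu]
      linear_combination (-D.b y z * (Y y - X x) ^ 2) * this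
    have e3 : ∑ y, D.a x y * (Y y ^ 2 - X x ^ 2) = ∑ y, u y ^ 2 + 2 * X x * ∑ y, u y := by
      rw [Finset.mul_sum, ← Finset.sum_add_distrib]
      refine Finset.sum_congr rfl fun y _ => ?_
      have := D.a_mul_self x y
      simp only [hu]
      linear_combination (-(Y y - X x) ^ 2) * this
    have e4 : ∑ z, (∑ y, D.a x y * D.b y z - D.c x z) * (Z z - X x) ^ 2
        = ∑ z, (∑ y, D.a x y * D.b y z) * (Z z - X x) ^ 2 - ∑ z, D.c x z * (Z z - X x) ^ 2 := by
      rw [← Finset.sum_sub_distrib]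
      exact Finset.sum_congr rfl fun z _ => by ring
    rw [derivP, linP, e1, e2, e3, e4, hsq]
    ring
  rw [hid]
  have : 0 ≤ ∑ z, D.c x z * (Z z - X x - ∑ y, D.b y z * u y) ^ 2 :=
    Finset.sum_nonneg fun z _ => mul_nonneg (D.c_nonneg x z) (sq_nonneg _)
  linarith

/-- The positive vector interpolating between the constant `1` and the indicator of not containing
the fixed point. -/
noncomputable def hP (s : ℝ) (x : P) : ℝ := s + (1 - s) * D.p x
noncomputable def hF (s : ℝ) (y : F) : ℝ := s + (1 - s) * D.f y
noncomputable def hH (s : ℝ) (z : H) : ℝ := s + (1 - s) * D.h z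

variable (s : ℝ)

/-- The constant part of the interpolating vector cancels in differences, so this and the next four
identities are the axioms of the structure scaled by 1 − s. -/
theorem sum_a_hP (x : P) : ∑ y, D.a x y * (D.hP s x - D.hF s y) = D.hP s x - s := by
  have : ∀ y, D.a x y * (D.hP s x - D.hF s y) = (1 - s) * (D.a x y * (D.p x - D.f y)) :=
    fun y => by simp only [hP, hF]; ring
  rw [Finset.sum_congr rfl fun y _ => this y, ← Finset.mul_sum, D.sum_a, hP]; ring

theorem sum_b_hF (y : F) : ∑ z, D.b y z * (D.hF s y - D.hH s z) = D.hF s y - s := by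
  have : ∀ z, D.b y z * (D.hF s y - D.hH s z) = (1 - s) * (D.b y z * (D.f y - D.h z)) :=
    fun z => by simp only [hH, hF]; ring
  rw [Finset.sum_congr rfl fun z _ => this z, ← Finset.mul_sum, D.sum_b, hF]; ring

theorem sum_wP_hP (y : F) :
    ∑ x, D.a x y * D.wP x * (D.hP s x - D.hF s y) = (1 - D.hF s y) * D.wF y := by
  have : ∀ x, D.a x y * D.wP x * (D.hP s x - D.hF s y)
      = (1 - s) * (D.a x y * D.wP x * (D.p x - D.f y)) :=
    fun x => by simp only [hP, hF]; ring
  rw [Finset.sum_congr rfl fun y _ => this y, ← Finset.mul_sum, D.sum_wP, hF]; ring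

theorem sum_wF_hF (z : H) :
    ∑ y, D.b y z * D.wF y * (D.hF s y - D.hH s z) = (1 - D.hH s z) * D.wH z := by
  have : ∀ y, D.b y z * D.wF y * (D.hF s y - D.hH s z)
      = (1 - s) * (D.b y z * D.wF y * (D.f y - D.h z)) :=
    fun x => by simp only [hH, hF]; ring
  rw [Finset.sum_congr rfl fun y _ => this y, ← Finset.mul_sum, D.sum_wF, hH]; ring

theorem sum_a_b_hP (x : P) (z : H) :
    ∑ y, D.a x y * D.b y z * (D.hP s x - D.hF s y) = D.c x z * (D.hP s x - D.hH s z) := by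
  have : ∀ y, D.a x y * D.b y z * (D.hP s x - D.hF s y)
      = (1 - s) * (D.a x y * D.b y z * (D.p x - D.f y)) :=
    fun x => by simp only [hP, hF]; ring
  rw [Finset.sum_congr rfl fun y _ => this y, ← Finset.mul_sum, D.sum_a_b, hP, hH]; ring

/-- Polarization: 2 (X − Y)(Z − Y) = (X − Y)² + (Y − Z)² − (X − Z)². This puts the derivative at the
middle level into the same squares as `derivP` and `derivH`. -/
theorem two_mul_linFDown_mul_linFUp (y : F) :
    2 * D.linFDown X Y y * D.linFUp Y Z y =
      ∑ x, ∑ z, D.a x y * D.b y z * D.wP x * (X x - Y y) ^ 2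
      + ∑ x, ∑ z, D.a x y * D.b y z * D.wP x * (Y y - Z z) ^ 2
      - ∑ x, ∑ z, D.a x y * D.b y z * D.wP x * (X x - Z z) ^ 2
      + ∑ x, D.a x y * D.wP x * (X x ^ 2 - Y y ^ 2 - (X x - Y y) ^ 2)
      + ∑ z, D.b y z * D.wF y * (Z z ^ 2 - Y y ^ 2 - (Y y - Z z) ^ 2)
      + 2 * D.wF y * Y y ^ 2 := by
  have e1 : 2 * ((∑ x, D.a x y * D.wP x * (X x - Y y)) * ∑ z, D.b y z * (Z z - Y y))
      = ∑ x, ∑ z, D.a x y * D.b y z * D.wP x * (X x - Y y) ^ 2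
      + ∑ x, ∑ z, D.a x y * D.b y z * D.wP x * (Y y - Z z) ^ 2
      - ∑ x, ∑ z, D.a x y * D.b y z * D.wP x * (X x - Z z) ^ 2 := by
    rw [Finset.sum_mul_sum, Finset.mul_sum, ← Finset.sum_add_distrib, ← Finset.sum_sub_distrib]
    refine Finset.sum_congr rfl fun x _ => ?_
    rw [Finset.mul_sum, ← Finset.sum_add_distrib, ← Finset.sum_sub_distrib]
    exact Finset.sum_congr rfl fun z _ => by ring
  have e2 : ∑ x, D.a x y * D.wP x * (X x ^ 2 - Y y ^ 2 - (X x - Y y) ^ 2)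
      = 2 * Y y * ∑ x, D.a x y * D.wP x * (X x - Y y) := by
    rw [Finset.mul_sum]
    exact Finset.sum_congr rfl fun z _ => by ring
  have e3 : ∑ z, D.b y z * D.wF y * (Z z ^ 2 - Y y ^ 2 - (Y y - Z z) ^ 2)
      = 2 * D.wF y * Y y * ∑ z, D.b y z * (Z z - Y y) := by
    rw [Finset.mul_sum]
    exact Finset.sum_congr rfl fun z _ => by ring
  rw [← e1, e2, e3, linFDown, linFUp]
  ring

/-- Euler's formula for the cubic form: the quadratic form is the combination of the derivatives. -/
theorem sum_deriv :
    ∑ x, D.hP s x * (D.wP x * D.derivP X Y Z x)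
      + ∑ y, D.hF s y * (2 * D.linFDown X Y y * D.linFUp Y Z y)
      + ∑ z, D.hH s z * D.derivH X Y Z z = D.upperForm Y Z + s * D.lowerForm X Y := by
  -- A1–A7 each sum out one index by means of the identities for differences of h. T1–T3 expand the
  -- three sums on the left.
  have A1 : ∑ x, ∑ y, D.a x y * (D.hP s x - D.hF s y) * D.wP x * X x ^ 2
      = ∑ x, (D.hP s x - s) * D.wP x * X x ^ 2 :=
    Finset.sum_congr rfl fun x _ => by rw [← D.sum_a_hP, Finset.sum_mul, Finset.sum_mul]
  have A2 : ∑ y, ∑ z, D.b y z * (D.hF s y - D.hH s z) * D.wF y * Y y ^ 2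
      = ∑ y, (D.hF s y - s) * D.wF y * Y y ^ 2 :=
    Finset.sum_congr rfl fun x _ => by rw [← D.sum_b_hF, Finset.sum_mul, Finset.sum_mul]
  have A3 : ∑ x, ∑ y, D.a x y * D.wP x * (D.hP s x - D.hF s y) * Y y ^ 2
      = ∑ y, (1 - D.hF s y) * D.wF y * Y y ^ 2 := by
    rw [Finset.sum_comm]
    exact Finset.sum_congr rfl fun x _ => by rw [← D.sum_wP_hP, Finset.sum_mul]
  have A4 : ∑ y, ∑ z, D.b y z * D.wF y * (D.hF s y - D.hH s z) * Z z ^ 2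
      = ∑ z, (1 - D.hH s z) * D.wH z * Z z ^ 2 := by
    rw [Finset.sum_comm]
    exact Finset.sum_congr rfl fun x _ => by rw [← D.sum_wF_hF, Finset.sum_mul]
  have A5 : ∑ x, ∑ y, ∑ z, D.a x y * D.b y z * (D.hP s x - D.hF s y) * D.wP x * (X x - Z z) ^ 2
      = ∑ x, ∑ z, D.c x z * (D.hP s x - D.hH s z) * D.wP x * (X x - Z z) ^ 2 := by
    refine Finset.sum_congr rfl fun x _ => ?_
    rw [Finset.sum_comm]
    exact Finset.sum_congr rfl fun z _ => by rw [← D.sum_a_b_hP, Finset.sum_mul, Finset.sum_mul]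
  have A6 : ∑ x, ∑ y, ∑ z, D.a x y * D.wP x * (D.hP s x - D.hF s y) * (D.b y z * (Y y - Z z) ^ 2)
      = ∑ y, ∑ z, (1 - D.hF s y) * D.wF y * (D.b y z * (Y y - Z z) ^ 2) := by
    rw [Finset.sum_comm]
    refine Finset.sum_congr rfl fun y _ => ?_
    rw [Finset.sum_comm]
    exact Finset.sum_congr rfl fun z _ => by rw [← D.sum_wP_hP, Finset.sum_mul]
  have A7 : ∑ x, ∑ y, ∑ z, D.b y z * (D.hF s y - D.hH s z) * (D.a x y * D.wP x * (X x - Y y) ^ 2)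
      = ∑ x, ∑ y, (D.hF s y - s) * (D.a x y * D.wP x * (X x - Y y) ^ 2) :=
    Finset.sum_congr rfl fun x _ => Finset.sum_congr rfl fun z _ => by
      rw [← D.sum_b_hF, Finset.sum_mul]
  have T1 : ∑ x, D.hP s x * (D.wP x * D.derivP X Y Z x)
      = ∑ x, D.hP s x * D.wP x * X x ^ 2
      + ∑ x, ∑ y, D.hP s x * (D.a x y * D.wP x * (Y y ^ 2 - X x ^ 2))
      - ∑ x, ∑ y, ∑ z, D.hP s x * (D.a x y * D.b y z * D.wP x * (Y y - Z z) ^ 2)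
      + ∑ x, ∑ y, ∑ z, D.hP s x * (D.a x y * D.b y z * D.wP x * (X x - Z z) ^ 2)
      - ∑ x, ∑ z, D.hP s x * (D.c x z * D.wP x * (X x - Z z) ^ 2) := by
    simp only [← Finset.sum_add_distrib, ← Finset.sum_sub_distrib]
    refine Finset.sum_congr rfl fun x _ => ?_
    have e1 : ∑ y, ∑ z, D.hP s x * (D.a x y * D.b y z * D.wP x * (X x - Z z) ^ 2)
        = D.hP s x * D.wP x * ∑ z, (∑ y, D.a x y * D.b y z) * (Z z - X x) ^ 2 := by
      rw [Finset.sum_comm, Finset.mul_sum]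
      refine Finset.sum_congr rfl fun z _ => ?_
      rw [Finset.sum_mul, Finset.mul_sum]
      exact Finset.sum_congr rfl fun y _ => by ring
    have e2 : ∑ z, D.hP s x * (D.c x z * D.wP x * (X x - Z z) ^ 2)
        = D.hP s x * D.wP x * ∑ z, D.c x z * (Z z - X x) ^ 2 := by
      rw [Finset.mul_sum]
      exact Finset.sum_congr rfl fun y _ => by ring
    have e3 : ∑ y, ∑ z, D.hP s x * (D.a x y * D.b y z * D.wP x * (Y y - Z z) ^ 2)
        = D.hP s x * D.wP x * ∑ y, ∑ z, D.a x y * D.b y z * (Y y - Z z) ^ 2 := by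
      simp only [Finset.mul_sum]
      exact Finset.sum_congr rfl fun y _ => Finset.sum_congr rfl fun z _ => by ring
    have e4 : ∑ y, D.hP s x * (D.a x y * D.wP x * (Y y ^ 2 - X x ^ 2))
        = D.hP s x * D.wP x * ∑ y, D.a x y * (Y y ^ 2 - X x ^ 2) := by
      simp only [Finset.mul_sum]
      exact Finset.sum_congr rfl fun y _ => by ring
    have e5 : ∑ z, (∑ y, D.a x y * D.b y z - D.c x z) * (Z z - X x) ^ 2
        = ∑ z, (∑ y, D.a x y * D.b y z) * (Z z - X x) ^ 2 - ∑ z, D.c x z * (Z z - X x) ^ 2 := by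
      rw [← Finset.sum_sub_distrib]
      exact Finset.sum_congr rfl fun z _ => by ring
    rw [e1, e2, e3, e4, derivP, e5]
    ring
  have T2 : ∑ y, D.hF s y * (2 * D.linFDown X Y y * D.linFUp Y Z y)
      = ∑ x, ∑ y, ∑ z, D.hF s y * (D.a x y * D.b y z * D.wP x * (X x - Y y) ^ 2)
      + ∑ x, ∑ y, ∑ z, D.hF s y * (D.a x y * D.b y z * D.wP x * (Y y - Z z) ^ 2)
      - ∑ x, ∑ y, ∑ z, D.hF s y * (D.a x y * D.b y z * D.wP x * (X x - Z z) ^ 2)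
      + ∑ x, ∑ y, D.hF s y * (D.a x y * D.wP x * (X x ^ 2 - Y y ^ 2 - (X x - Y y) ^ 2))
      + ∑ y, ∑ z, D.hF s y * (D.b y z * D.wF y * (Z z ^ 2 - Y y ^ 2 - (Y y - Z z) ^ 2))
      + ∑ y, D.hF s y * (2 * D.wF y * Y y ^ 2) := by
    rw [Finset.sum_comm (f := fun x y => ∑ z,
        D.hF s y * (D.a x y * D.b y z * D.wP x * (X x - Y y) ^ 2)),
      Finset.sum_comm (f := fun x y => ∑ z,
        D.hF s y * (D.a x y * D.b y z * D.wP x * (Y y - Z z) ^ 2)),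
      Finset.sum_comm (f := fun x y => ∑ z,
        D.hF s y * (D.a x y * D.b y z * D.wP x * (X x - Z z) ^ 2)),
      Finset.sum_comm (f := fun x y =>
        D.hF s y * (D.a x y * D.wP x * (X x ^ 2 - Y y ^ 2 - (X x - Y y) ^ 2)))]
    simp only [← Finset.sum_add_distrib, ← Finset.sum_sub_distrib]
    refine Finset.sum_congr rfl fun y _ => ?_
    rw [D.two_mul_linFDown_mul_linFUp]
    simp only [Finset.mul_sum, mul_add, mul_sub, Finset.sum_add_distrib, Finset.sum_sub_distrib]
  have T3 : ∑ z, D.hH s z * D.derivH X Y Z z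
      = ∑ x, ∑ z, D.hH s z * (D.c x z * D.wP x * (X x - Z z) ^ 2)
      + ∑ y, ∑ z, D.hH s z * (D.b y z * D.wF y * (Y y ^ 2 - Z z ^ 2))
      - ∑ x, ∑ y, ∑ z, D.hH s z * (D.a x y * D.b y z * D.wP x * (X x - Y y) ^ 2)
      + ∑ z, D.hH s z * (D.wH z * Z z ^ 2) := by
    have e0 : ∑ x, ∑ y, ∑ z, D.hH s z * (D.a x y * D.b y z * D.wP x * (X x - Y y) ^ 2)
        = ∑ z, ∑ x, ∑ y, D.hH s z * (D.a x y * D.b y z * D.wP x * (X x - Y y) ^ 2) := by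
      rw [Finset.sum_comm (s := (Finset.univ : Finset H))]
      exact Finset.sum_congr rfl fun x _ => Finset.sum_comm
    rw [e0, Finset.sum_comm (f := fun x z => D.hH s z * (D.c x z * D.wP x * (X x - Z z) ^ 2)),
      Finset.sum_comm (f := fun y z => D.hH s z * (D.b y z * D.wF y * (Y y ^ 2 - Z z ^ 2)))]
    simp only [← Finset.sum_add_distrib, ← Finset.sum_sub_distrib]
    refine Finset.sum_congr rfl fun z _ => ?_
    simp only [derivH, Finset.mul_sum, mul_add, mul_sub]
  -- In the triple sums the coefficient of each square is a difference of values of h at adjacent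
  -- levels, so A5, A6 and A7 collapse them to double sums.
  have G3 : - ∑ x, ∑ y, ∑ z, D.hP s x * (D.a x y * D.b y z * D.wP x * (Y y - Z z) ^ 2)
      + ∑ x, ∑ y, ∑ z, D.hP s x * (D.a x y * D.b y z * D.wP x * (X x - Z z) ^ 2)
      + ∑ x, ∑ y, ∑ z, D.hF s y * (D.a x y * D.b y z * D.wP x * (X x - Y y) ^ 2)
      + ∑ x, ∑ y, ∑ z, D.hF s y * (D.a x y * D.b y z * D.wP x * (Y y - Z z) ^ 2)
      - ∑ x, ∑ y, ∑ z, D.hF s y * (D.a x y * D.b y z * D.wP x * (X x - Z z) ^ 2)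
      - ∑ x, ∑ y, ∑ z, D.hH s z * (D.a x y * D.b y z * D.wP x * (X x - Y y) ^ 2)
      = ∑ x, ∑ z, D.c x z * (D.hP s x - D.hH s z) * D.wP x * (X x - Z z) ^ 2
      - ∑ y, ∑ z, (1 - D.hF s y) * D.wF y * (D.b y z * (Y y - Z z) ^ 2)
      + ∑ x, ∑ y, (D.hF s y - s) * (D.a x y * D.wP x * (X x - Y y) ^ 2) := by
    rw [← A5, ← A6, ← A7]
    simp only [← Finset.sum_add_distrib, ← Finset.sum_sub_distrib, ← Finset.sum_neg_distrib]
    exact Finset.sum_congr rfl fun x _ => Finset.sum_congr rfl fun y _ =>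
      Finset.sum_congr rfl fun z _ => by ring
  have G2a : ∑ x, ∑ y, D.hP s x * (D.a x y * D.wP x * (Y y ^ 2 - X x ^ 2))
      + ∑ x, ∑ y, D.hF s y * (D.a x y * D.wP x * (X x ^ 2 - Y y ^ 2 - (X x - Y y) ^ 2))
      + ∑ x, ∑ y, (D.hF s y - s) * (D.a x y * D.wP x * (X x - Y y) ^ 2)
      = - ∑ x, (D.hP s x - s) * D.wP x * X x ^ 2 + ∑ y, (1 - D.hF s y) * D.wF y * Y y ^ 2
        - s * ∑ x, ∑ y, D.a x y * D.wP x * (X x - Y y) ^ 2 := by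
    rw [← A1, ← A3]
    simp only [← Finset.sum_add_distrib, ← Finset.sum_sub_distrib, ← Finset.sum_neg_distrib,
      Finset.mul_sum]
    exact Finset.sum_congr rfl fun x _ => Finset.sum_congr rfl fun y _ => by ring
  have G2b : ∑ y, ∑ z, D.hF s y * (D.b y z * D.wF y * (Z z ^ 2 - Y y ^ 2 - (Y y - Z z) ^ 2))
      + ∑ y, ∑ z, D.hH s z * (D.b y z * D.wF y * (Y y ^ 2 - Z z ^ 2))
      - ∑ y, ∑ z, (1 - D.hF s y) * D.wF y * (D.b y z * (Y y - Z z) ^ 2)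
      = - ∑ y, (D.hF s y - s) * D.wF y * Y y ^ 2 + ∑ z, (1 - D.hH s z) * D.wH z * Z z ^ 2
        - ∑ y, ∑ z, D.b y z * D.wF y * (Y y - Z z) ^ 2 := by
    rw [← A2, ← A4]
    simp only [← Finset.sum_add_distrib, ← Finset.sum_sub_distrib, ← Finset.sum_neg_distrib]
    exact Finset.sum_congr rfl fun x _ => Finset.sum_congr rfl fun y _ => by ring
  have G2c : ∑ x, ∑ z, D.c x z * (D.hP s x - D.hH s z) * D.wP x * (X x - Z z) ^ 2
      - ∑ x, ∑ z, D.hP s x * (D.c x z * D.wP x * (X x - Z z) ^ 2)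
      + ∑ x, ∑ z, D.hH s z * (D.c x z * D.wP x * (X x - Z z) ^ 2) = 0 := by
    simp only [← Finset.sum_add_distrib, ← Finset.sum_sub_distrib]
    exact Finset.sum_eq_zero fun x _ => Finset.sum_eq_zero fun y _ => by ring
  have G1a : ∑ x, D.hP s x * D.wP x * X x ^ 2 - ∑ x, (D.hP s x - s) * D.wP x * X x ^ 2
      = s * ∑ x, D.wP x * X x ^ 2 := by
    simp only [← Finset.sum_sub_distrib, Finset.mul_sum]
    exact Finset.sum_congr rfl fun y _ => by ring
  have G1b : ∑ y, (1 - D.hF s y) * D.wF y * Y y ^ 2 - ∑ y, (D.hF s y - s) * D.wF y * Y y ^ 2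
      + ∑ y, D.hF s y * (2 * D.wF y * Y y ^ 2) = (1 + s) * ∑ y, D.wF y * Y y ^ 2 := by
    simp only [← Finset.sum_sub_distrib, ← Finset.sum_add_distrib, Finset.mul_sum]
    exact Finset.sum_congr rfl fun y _ => by ring
  have G1c : ∑ z, (1 - D.hH s z) * D.wH z * Z z ^ 2 + ∑ z, D.hH s z * (D.wH z * Z z ^ 2)
      = ∑ z, D.wH z * Z z ^ 2 := by
    simp only [← Finset.sum_add_distrib]
    exact Finset.sum_congr rfl fun y _ => by ring
  rw [T1, T2, T3, upperForm, lowerForm]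
  linear_combination G3 + G2a + G2b + G2c + G1a + G1b + G1c

/-- This and the next three values say that the matrix of `upperForm + s * lowerForm` sends h to (s²
`wP`, 2 s `wF`, `wH`), the vector d of the reverse Cauchy–Schwarz inequality. -/
theorem linP_h (x : P) : D.linP (D.hP s) (D.hF s) x = s := by
  have h1 := D.sum_a_hP s x
  have h2 : ∑ y, D.a x y * (D.hF s y - D.hP s x) = -∑ y, D.a x y * (D.hP s x - D.hF s y) := by
    rw [← Finset.sum_neg_distrib]
    exact Finset.sum_congr rfl fun y _ => by ring
  rw [linP, h2, h1]; ring

theorem linFUp_h (y : F) : D.linFUp (D.hF s) (D.hH s) y = s := by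
  have h1 := D.sum_b_hF s y
  have h2 : ∑ z, D.b y z * (D.hH s z - D.hF s y) = -∑ z, D.b y z * (D.hF s y - D.hH s z) := by
    rw [← Finset.sum_neg_distrib]
    exact Finset.sum_congr rfl fun y _ => by ring
  rw [linFUp, h2, h1]; ring

theorem linFDown_h (y : F) : D.linFDown (D.hP s) (D.hF s) y = D.wF y := by
  rw [linFDown, D.sum_wP_hP]; ring

theorem linH_h (z : H) : D.linH (D.hF s) (D.hH s) z = D.wH z := by
  rw [linH, D.sum_wF_hF]; ring

variable {s}

theorem hP_pos (hs : 0 < s) (hs1 : s < 1) (x : P) : 0 < D.hP s x := by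
  have := mul_nonneg (sub_nonneg.2 hs1.le) (D.p_mem x).1
  rw [hP]; linarith

theorem hF_pos (hs : 0 < s) (hs1 : s < 1) (y : F) : 0 < D.hF s y := by
  have := mul_nonneg (sub_nonneg.2 hs1.le) (D.f_mem y).1
  rw [hF]; linarith

theorem hH_pos (hs : 0 < s) (hs1 : s < 1) (z : H) : 0 < D.hH s z := by
  have := mul_nonneg (sub_nonneg.2 hs1.le) (D.h_mem z).1
  rw [hH]; linarith

/-- The quadratic form is bounded by the norm of its gradient, in the metric defined by the
gradient at the vector `h`. -/
theorem form_le (hs : 0 < s) (hs1 : s < 1) :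
    D.upperForm Y Z + s * D.lowerForm X Y ≤
      ∑ x, D.hP s x * (s * D.wP x * D.linP X Y x) ^ 2 / (s ^ 2 * D.wP x)
      + ∑ y, D.hF s y * (D.wF y * D.linFUp Y Z y + s * D.linFDown X Y y) ^ 2 / (2 * s * D.wF y)
      + ∑ z, D.hH s z * D.linH Y Z z ^ 2 / D.wH z := by
  rw [← D.sum_deriv]
  refine add_le_add (add_le_add (Finset.sum_le_sum fun x _ => ?_)
    (Finset.sum_le_sum fun y _ => ?_)) (Finset.sum_le_sum fun z _ => ?_)
  · have h1 := D.wP_pos x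
    rw [mul_div_assoc]
    refine mul_le_mul_of_nonneg_left ?_ (D.hP_pos hs hs1 x).le
    have : (s * D.wP x * D.linP X Y x) ^ 2 / (s ^ 2 * D.wP x) = D.wP x * D.linP X Y x ^ 2 := by
      field_simp
    rw [this]
    exact mul_le_mul_of_nonneg_left (D.derivP_le X Y Z x) h1.le
  · have h1 := D.wF_pos y
    rw [mul_div_assoc]
    refine mul_le_mul_of_nonneg_left ?_ (D.hF_pos hs hs1 y).le
    rw [le_div_iff₀ (by positivity)]
    -- 4 a b ≤ (a + b)² with a = `wF` · `linFUp` and b = s · `linFDown`; no sign of either factor is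
    -- needed.
    nlinarith [sq_nonneg (D.wF y * D.linFUp Y Z y - s * D.linFDown X Y y)]
  · have h1 := D.wH_pos z
    rw [mul_div_assoc]
    refine mul_le_mul_of_nonneg_left ?_ (D.hH_pos hs hs1 z).le
    rw [le_div_iff₀ h1, mul_comm]
    exact D.derivH_le X Y Z z

end WeightedLevels

/-! ### Matrix of the three-level form and the limit s → 0 -/

namespace WeightedLevels

variable {P F H : Type*} [Fintype P] [Fintype F] [Fintype H] (D : WeightedLevels P F H)
  (X : P → ℝ) (Y : F → ℝ) (Z : H → ℝ) {s : ℝ}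

theorem a_nonneg (x : P) (y : F) : 0 ≤ D.a x y := by
  rw [← D.a_mul_self]; exact mul_self_nonneg _

theorem b_nonneg (y : F) (z : H) : 0 ≤ D.b y z := by
  rw [← D.b_mul_self]; exact mul_self_nonneg _

open Classical in
/-- The matrix of the quadratic form `upperForm + s * lowerForm`. -/
noncomputable def formMatrix (s : ℝ) : P ⊕ F ⊕ H → P ⊕ F ⊕ H → ℝ
  | .inl x, .inl x' => if x = x' then s * D.wP x * (1 - ∑ y, D.a x y) else 0
  | .inl x, .inr (.inl y) => s * (D.a x y * D.wP x)
  | .inl _, .inr (.inr _) => 0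
  | .inr (.inl y), .inl x => s * (D.a x y * D.wP x)
  | .inr (.inl y), .inr (.inl y') => if y = y' then
      D.wF y * (1 - ∑ z, D.b y z) + s * (D.wF y - ∑ x, D.a x y * D.wP x) else 0
  | .inr (.inl y), .inr (.inr z) => D.b y z * D.wF y
  | .inr (.inr _), .inl _ => 0
  | .inr (.inr z), .inr (.inl y) => D.b y z * D.wF y
  | .inr (.inr z), .inr (.inr z') => if z = z' then D.wH z - ∑ y, D.b y z * D.wF y else 0

theorem sum_formMatrix_inl (x : P) :
    ∑ v, D.formMatrix s (.inl x) v * Sum.elim X (Sum.elim Y Z) v = s * D.wP x * D.linP X Y x := by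
  classical
  simp only [Fintype.sum_sum_type, Sum.elim_inl, Sum.elim_inr, formMatrix, ite_mul, zero_mul,
    Finset.sum_ite_eq, Finset.mem_univ, if_true, Finset.sum_const_zero, add_zero, linP]
  simp only [mul_sub, Finset.sum_sub_distrib, ← Finset.sum_mul]
  have : ∑ y, s * (D.a x y * D.wP x) * Y y = s * D.wP x * ∑ y, D.a x y * Y y := by
    rw [Finset.mul_sum]; exact Finset.sum_congr rfl fun y _ => by ring
  rw [this]; ring

theorem sum_formMatrix_mid (y : F) :
    ∑ v, D.formMatrix s (.inr (.inl y)) v * Sum.elim X (Sum.elim Y Z) v =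
      D.wF y * D.linFUp Y Z y + s * D.linFDown X Y y := by
  classical
  simp only [Fintype.sum_sum_type, Sum.elim_inl, Sum.elim_inr, formMatrix, ite_mul, zero_mul,
    Finset.sum_ite_eq, Finset.mem_univ, if_true, linFUp, linFDown]
  simp only [mul_sub, Finset.sum_sub_distrib, ← Finset.sum_mul]
  have h1 : ∑ x, s * (D.a x y * D.wP x) * X x = s * ∑ x, D.a x y * D.wP x * X x := by
    rw [Finset.mul_sum]; exact Finset.sum_congr rfl fun y _ => by ring
  have h2 : ∑ z, D.b y z * D.wF y * Z z = D.wF y * ∑ z, D.b y z * Z z := by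
    rw [Finset.mul_sum]; exact Finset.sum_congr rfl fun y _ => by ring
  rw [h1, h2]; ring

theorem sum_formMatrix_inr (z : H) :
    ∑ v, D.formMatrix s (.inr (.inr z)) v * Sum.elim X (Sum.elim Y Z) v = D.linH Y Z z := by
  classical
  simp only [Fintype.sum_sum_type, Sum.elim_inl, Sum.elim_inr, formMatrix, ite_mul, zero_mul,
    Finset.sum_ite_eq, Finset.mem_univ, if_true, Finset.sum_const_zero, zero_add, linH]
  simp only [mul_sub, Finset.sum_sub_distrib, ← Finset.sum_mul]
  ring

theorem form_eq (s : ℝ) :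
    ∑ u, Sum.elim X (Sum.elim Y Z) u * ∑ v, D.formMatrix s u v * Sum.elim X (Sum.elim Y Z) v
      = D.upperForm Y Z + s * D.lowerForm X Y := by
  rw [Fintype.sum_sum_type, Fintype.sum_sum_type]
  simp only [sum_formMatrix_inl, sum_formMatrix_mid, sum_formMatrix_inr, Sum.elim_inl,
    Sum.elim_inr]
  have e1 : ∑ x, X x * (s * D.wP x * D.linP X Y x) = s * (∑ x, D.wP x * X x ^ 2
      + ∑ x, ∑ y, D.a x y * D.wP x * (X x * (Y y - X x))) := by
    rw [← Finset.sum_add_distrib, Finset.mul_sum]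
    refine Finset.sum_congr rfl fun x _ => ?_
    have : ∑ y, D.a x y * D.wP x * (X x * (Y y - X x))
        = D.wP x * X x * ∑ y, D.a x y * (Y y - X x) := by
      rw [Finset.mul_sum]; exact Finset.sum_congr rfl fun y _ => by ring
    rw [this, linP]; ring
  have e2 : ∑ y, Y y * (D.wF y * D.linFUp Y Z y + s * D.linFDown X Y y)
      = (1 + s) * ∑ y, D.wF y * Y y ^ 2
      + ∑ y, ∑ z, D.b y z * D.wF y * (Y y * (Z z - Y y))
      + s * ∑ x, ∑ y, D.a x y * D.wP x * (Y y * (X x - Y y)) := by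
    rw [Finset.sum_comm (f := fun x y => D.a x y * D.wP x * (Y y * (X x - Y y))),
      Finset.mul_sum, Finset.mul_sum, ← Finset.sum_add_distrib, ← Finset.sum_add_distrib]
    refine Finset.sum_congr rfl fun y _ => ?_
    have h1 : ∑ z, D.b y z * D.wF y * (Y y * (Z z - Y y))
        = D.wF y * Y y * ∑ z, D.b y z * (Z z - Y y) := by
      rw [Finset.mul_sum]; exact Finset.sum_congr rfl fun y _ => by ring
    have h2 : ∑ x, D.a x y * D.wP x * (Y y * (X x - Y y))
        = Y y * ∑ x, D.a x y * D.wP x * (X x - Y y) := by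
      rw [Finset.mul_sum]; exact Finset.sum_congr rfl fun y _ => by ring
    rw [h1, h2, linFUp, linFDown]; ring
  have e3 : ∑ z, Z z * D.linH Y Z z = ∑ z, D.wH z * Z z ^ 2
      + ∑ y, ∑ z, D.b y z * D.wF y * (Z z * (Y y - Z z)) := by
    rw [Finset.sum_comm, ← Finset.sum_add_distrib]
    refine Finset.sum_congr rfl fun z _ => ?_
    have h2 : ∑ y, D.b y z * D.wF y * (Z z * (Y y - Z z))
        = Z z * ∑ y, D.b y z * D.wF y * (Y y - Z z) := by
      rw [Finset.mul_sum]; exact Finset.sum_congr rfl fun y _ => by ring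
    rw [h2, linH]; ring
  have f1 : ∑ x, ∑ y, D.a x y * D.wP x * (X x - Y y) ^ 2
      = - (∑ x, ∑ y, D.a x y * D.wP x * (X x * (Y y - X x))
        + ∑ x, ∑ y, D.a x y * D.wP x * (Y y * (X x - Y y))) := by
    simp only [← Finset.sum_add_distrib, ← Finset.sum_neg_distrib]
    exact Finset.sum_congr rfl fun x _ => Finset.sum_congr rfl fun y _ => by ring
  have f2 : ∑ y, ∑ z, D.b y z * D.wF y * (Y y - Z z) ^ 2
      = - (∑ y, ∑ z, D.b y z * D.wF y * (Y y * (Z z - Y y))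
        + ∑ y, ∑ z, D.b y z * D.wF y * (Z z * (Y y - Z z))) := by
    simp only [← Finset.sum_add_distrib, ← Finset.sum_neg_distrib]
    exact Finset.sum_congr rfl fun x _ => Finset.sum_congr rfl fun y _ => by ring
  rw [e1, e2, e3, upperForm, lowerForm, f1, f2]
  ring

/-- The spectral criterion for `formMatrix`, with `form_le` as its main hypothesis. Taking s > 0
makes h and its image positive and keeps the edges between `P` and `F`, so that `connected` applies.
-/
theorem reverse_cauchySchwarz (hs : 0 < s) (hs1 : s < 1) :
    (D.upperForm Y Z + s * D.lowerForm X Y) *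
      (∑ x, s ^ 2 * D.wP x * D.hP s x + (∑ y, 2 * s * D.wF y * D.hF s y
        + ∑ z, D.wH z * D.hH s z)) ≤
      (∑ x, s ^ 2 * D.wP x * X x + (∑ y, 2 * s * D.wF y * Y y + ∑ z, D.wH z * Z z)) ^ 2 := by
  classical
  have key := Matrix.reverse_cauchySchwarz (D.formMatrix s)
    (Sum.elim (D.hP s) (Sum.elim (D.hF s) (D.hH s)))
    (Sum.elim (fun x => s ^ 2 * D.wP x) (Sum.elim (fun y => 2 * s * D.wF y) D.wH))
    (by
      rintro (x | y | z) (x' | y' | z') <;> simp only [formMatrix]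
      · rcases eq_or_ne x x' with rfl | h
        · rfl
        · rw [if_neg h, if_neg h.symm]
      · rcases eq_or_ne y y' with rfl | h
        · rfl
        · rw [if_neg h, if_neg h.symm]
      · rcases eq_or_ne z z' with rfl | h
        · rfl
        · rw [if_neg h, if_neg h.symm])
    (by
      have hA := fun x y => mul_nonneg hs.le (mul_nonneg (D.a_nonneg x y) (D.wP_pos x).le)
      have hB := fun y z => mul_nonneg (D.b_nonneg y z) (D.wF_pos y).le
      rintro (x | y | z) (x' | y' | z') huv <;> simp only [formMatrix]
      · rw [if_neg fun h => huv (by rw [h])]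
      · exact hA x y'
      · exact le_rfl
      · exact hA x' y
      · rw [if_neg fun h => huv (by rw [h])]
      · exact hB y z'
      · exact le_rfl
      · exact hB y' z
      · rw [if_neg fun h => huv (by rw [h])])
    (by
      rintro (x | y | z)
      · exact D.hP_pos hs hs1 x
      · exact D.hF_pos hs hs1 y
      · exact D.hH_pos hs hs1 z)
    (by
      rintro (x | y | z)
      · exact mul_pos (by positivity) (D.wP_pos x)
      · exact mul_pos (by positivity) (D.wF_pos y)
      · exact D.wH_pos z)
    (by
      rintro (x | y | z)
      · rw [sum_formMatrix_inl, linP_h, Sum.elim_inl]; ring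
      · rw [sum_formMatrix_mid, linFUp_h, linFDown_h, Sum.elim_inr, Sum.elim_inl]; ring
      · rw [sum_formMatrix_inr, linH_h, Sum.elim_inr, Sum.elim_inr])
    (by
      intro g hg
      obtain ⟨t, h1, h2, h3⟩ := D.connected (fun x => g (.inl x)) (fun y => g (.inr (.inl y)))
        (fun z => g (.inr (.inr z)))
        (fun x y hxy => hg _ _ (by simp) (by
          have := D.wP_pos x
          simp only [formMatrix, hxy]; positivity))
        (fun y z hyz => hg _ _ (by simp) (by
          have := D.wF_pos y
          simp only [formMatrix, hyz]; positivity))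
      have : ∀ u, g u = t := by
        rintro (x | y | z)
        exacts [h1 x, h2 y, h3 z]
      intro u v
      rw [this, this])
    (by
      intro x
      obtain ⟨X, Y, Z, rfl⟩ : ∃ X Y Z, x = Sum.elim X (Sum.elim Y Z) :=
        ⟨fun a => x (.inl a), fun a => x (.inr (.inl a)), fun a => x (.inr (.inr a)), by
          funext u; rcases u with u | u | u <;> rfl⟩
      rw [form_eq]
      refine (D.form_le X Y Z hs hs1).trans (le_of_eq ?_)
      rw [Fintype.sum_sum_type, Fintype.sum_sum_type]
      simp only [sum_formMatrix_inl, sum_formMatrix_mid, sum_formMatrix_inr, Sum.elim_inl,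
        Sum.elim_inr]
      ring)
    (Sum.elim X (Sum.elim Y Z))
  rw [form_eq] at key
  simpa only [Fintype.sum_sum_type, Sum.elim_inl, Sum.elim_inr] using key

/-- The reverse Cauchy–Schwarz inequality for the form of the two upper levels. -/
theorem upperForm_mul_le :
    (∑ z, D.wH z * D.h z) * D.upperForm Y Z ≤ (∑ z, D.wH z * Z z) ^ 2 := by
  -- At X = 0 the inequality is a closed condition in s. In the limit s = 0 the lower level
  -- disappears and `hH` becomes the indicator `h`.
  have key : ∀ s ∈ Set.Ioo (0 : ℝ) 1, 0 ≤
      (∑ x, s ^ 2 * D.wP x * (0 : ℝ) + (∑ y, 2 * s * D.wF y * Y y + ∑ z, D.wH z * Z z)) ^ 2 -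
      (D.upperForm Y Z + s * D.lowerForm (fun _ => 0) Y) *
      (∑ x, s ^ 2 * D.wP x * D.hP s x + (∑ y, 2 * s * D.wF y * D.hF s y
        + ∑ z, D.wH z * D.hH s z)) := fun s hs =>
    sub_nonneg.2 (D.reverse_cauchySchwarz (fun _ => 0) Y Z hs.1 hs.2)
  have hcont : Continuous fun s : ℝ =>
      (∑ x, s ^ 2 * D.wP x * (0 : ℝ) + (∑ y, 2 * s * D.wF y * Y y + ∑ z, D.wH z * Z z)) ^ 2 -
      (D.upperForm Y Z + s * D.lowerForm (fun _ => 0) Y) *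
      (∑ x, s ^ 2 * D.wP x * D.hP s x + (∑ y, 2 * s * D.wF y * D.hF s y
        + ∑ z, D.wH z * D.hH s z)) := by
    unfold hP hF hH
    fun_prop
  have h0 : (0 : ℝ) ∈ closure (Set.Ioo (0 : ℝ) 1) := by
    rw [closure_Ioo zero_ne_one]; exact ⟨le_rfl, zero_le_one⟩
  have h1 := closure_minimal (s := Set.Ioo (0 : ℝ) 1) key (isClosed_le continuous_const hcont) h0
  have h2 : 0 ≤
      (∑ x, (0 : ℝ) ^ 2 * D.wP x * (0 : ℝ) + (∑ y, 2 * 0 * D.wF y * Y y + ∑ z, D.wH z * Z z)) ^ 2 -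
      (D.upperForm Y Z + 0 * D.lowerForm (fun _ => 0) Y) *
      (∑ x, (0 : ℝ) ^ 2 * D.wP x * D.hP 0 x + (∑ y, 2 * 0 * D.wF y * D.hF 0 y
        + ∑ z, D.wH z * D.hH 0 z)) := h1
  simp only [hH, hP, hF] at h2
  simp at h2
  linarith

end WeightedLevels

/-! ### Flats, Weisner's theorem and positivity of the weights -/

namespace Matroid

variable {α : Type*} (M : Matroid α) {F G P : Set α} {i : α} {k : ℕ}

/-- The rank of a set in a finite matroid, as a natural number. -/
noncomputable def natRk (X : Set α) : ℕ := (M.eRk X).toNat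

theorem natRk_ground : M.natRk M.E = M.natRank := by
  rw [natRk, natRank, eRk_ground]

theorem natRk_empty : M.natRk ∅ = 0 := by simp [natRk]

theorem natRk_closure (X : Set α) : M.natRk (M.closure X) = M.natRk X := by
  rw [natRk, eRk_closure_eq, natRk]

variable {M}

theorem IsFlat.insert_subset_closure (hP : M.IsFlat P) (hi : i ∈ M.E) :
    insert i P ⊆ M.closure (insert i P) :=
  M.subset_closure _ (Set.insert_subset hi hP.subset_ground)

theorem IsFlat.closure_insert_subset (hG : M.IsFlat G) (hi : i ∈ G) (h : P ⊆ G) :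
    M.closure (insert i P) ⊆ G := by
  have := M.closure_subset_closure (Set.insert_subset hi h)
  rwa [hG.closure] at this

theorem IsFlat.inter {F G : Set α} (hF : M.IsFlat F) (hG : M.IsFlat G) : M.IsFlat (F ∩ G) := by
  rw [Set.inter_eq_iInter]
  exact IsFlat.iInter fun b => by cases b <;> assumption

theorem isFlat_empty_of_loopless [M.Loopless] : M.IsFlat ∅ := by
  rw [← M.loops_eq_empty]; exact M.isFlat_closure ∅

/-- A flat contained in a flat `F` and avoiding a point of `F` lies in a hyperplane of `F` avoiding
this point. -/
theorem IsFlat.exists_isFlat_notMem (hF : M.IsFlat F) (hG : M.IsFlat G) (hGF : G ⊆ F) (hi : i ∈ F)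
    (hiG : i ∉ G) (hr : M.natRk F = k + 1) :
    ∃ P, M.IsFlat P ∧ P ⊆ F ∧ M.natRk P = k ∧ i ∉ P ∧ G ⊆ P := by
  -- A basis of `G` together with `i` is independent and extends to a basis `I` of `F`; the
  -- hyperplane sought is the closure of `I \ {i}`.
  obtain ⟨J, hJ⟩ := M.exists_isBasis G hG.subset_ground
  have hiJ : i ∉ J := fun h => hiG (hJ.subset h)
  have hind : M.Indep (insert i J) := by
    rw [hJ.indep.insert_indep_iff_of_notMem hiJ, hJ.closure_eq_closure, hG.closure]
    exact ⟨hF.subset_ground hi, hiG⟩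
  obtain ⟨I, hI, hJI⟩ := hind.subset_isBasis_of_subset
    (Set.insert_subset hi (hJ.subset.trans hGF)) hF.subset_ground
  have hiI : i ∈ I := hJI (Set.mem_insert _ _)
  refine ⟨M.closure (I \ {i}), M.isFlat_closure _, ?_, ?_, ?_, ?_⟩
  · have := M.closure_subset_closure ((Set.sdiff_subset (t := {i})).trans hI.subset)
    rwa [hF.closure] at this
  · have h1 : M.natRk I = I.ncard := by
      rw [natRk, hI.indep.eRk_eq_encard]; rfl
    have h2 : M.natRk (I \ {i}) = (I \ {i}).ncard := by
      rw [natRk, (hI.indep.subset Set.sdiff_subset).eRk_eq_encard]; rfl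
    have h3 : M.natRk I = M.natRk F := by rw [natRk, hI.eRk_eq_eRk, natRk]
    rw [natRk_closure, h2, Set.ncard_sdiff_singleton_of_mem hiI, ← h1, h3, hr]; rfl
  · exact hI.indep.notMem_closure_sdiff_of_mem hiI
  · rw [← hG.closure, ← hJ.closure_eq_closure]
    refine M.closure_subset_closure fun j hj => ⟨hJI (Set.mem_insert_of_mem _ hj), ?_⟩
    rintro rfl
    exact hiJ hj

variable (M) [M.Finite]

theorem cast_natRk (X : Set α) : (M.natRk X : ℕ∞) = M.eRk X :=
  ENat.natCast_toNat (eRk_ne_top_iff.2 (M.isRkFinite_set X))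

variable {M}

theorem IsFlat.natRk_closure_insert (hP : M.IsFlat P) (hi : i ∈ M.E) (hiP : i ∉ P) :
    M.natRk (M.closure (insert i P)) = M.natRk P + 1 := by
  have := M.eRk_insert_eq_add_one (e := i) (X := P) ⟨hi, by rwa [hP.closure]⟩
  rw [← cast_natRk, ← cast_natRk] at this
  rw [natRk_closure]
  exact_mod_cast this

theorem IsFlat.eq_of_natRk_le (hF : M.IsFlat F) (hG : M.IsFlat G) (h : F ⊆ G)
    (hr : M.natRk G ≤ M.natRk F) : F = G := by
  have h1 : M.eRk G ≤ M.eRk F := by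
    rw [← cast_natRk, ← cast_natRk]; exact_mod_cast hr
  have := (M.isRkFinite_set F).closure_eq_closure_of_subset_of_eRk_ge_eRk h h1
  rwa [hF.closure, hG.closure] at this

/-- A flat covering `P` and containing `i ∉ P` is the closure of `insert i P`. -/
theorem IsFlat.closure_insert_eq (hP : M.IsFlat P) (hF : M.IsFlat F) (h : P ⊆ F)
    (hr : M.natRk F = M.natRk P + 1) (hi : i ∈ F) (hiP : i ∉ P) :
    M.closure (insert i P) = F := by
  refine (M.isFlat_closure _).eq_of_natRk_le hF (hF.closure_insert_subset hi h) ?_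
  rw [hP.natRk_closure_insert (hF.subset_ground hi) hiP, hr]

theorem IsFlat.eq_empty_of_natRk_eq_zero [M.Loopless] (hF : M.IsFlat F) (h : M.natRk F = 0) :
    F = ∅ :=
  (isFlat_empty_of_loopless.eq_of_natRk_le hF (Set.empty_subset _) (by omega)).symm

variable (M)

/-- The finite set of flats of a finite matroid. -/
noncomputable def flats : Finset (Set α) :=
  (M.ground_finite.finite_subsets.subset fun _ hF => hF.subset_ground :
    {F | M.IsFlat F}.Finite).toFinset

@[simp] theorem mem_flats : F ∈ M.flats ↔ M.IsFlat F := by simp [flats]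

open Classical in
/-- The flats of rank `k` contained in `G`. -/
noncomputable def flatsIn (G : Set α) (k : ℕ) : Finset (Set α) :=
  M.flats.filter fun F => F ⊆ G ∧ M.natRk F = k

@[simp] theorem mem_flatsIn : F ∈ M.flatsIn G k ↔ M.IsFlat F ∧ F ⊆ G ∧ M.natRk F = k := by
  simp [flatsIn]

open Classical in
/-- The Möbius function of the lattice of flats of a loopless matroid. -/
noncomputable def flatMoebius (F : Set α) : ℤ :=
  if F = ∅ then 1 else
    -∑ P ∈ (M.flats.filter fun P => P ⊂ F).attach, flatMoebius P.1
termination_by (M.flats.filter fun P => P ⊂ F).card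
decreasing_by
  have hP := P.2
  rw [Finset.mem_filter] at hP
  refine Finset.card_lt_card (Finset.ssubset_iff_of_subset ?_ |>.2 ⟨P.1, P.2, ?_⟩)
  · intro Q hQ
    rw [Finset.mem_filter] at hQ ⊢
    exact ⟨hQ.1, hQ.2.trans hP.2⟩
  · rw [Finset.mem_filter]
    exact fun h => h.2.ne rfl

theorem flatMoebius_empty : M.flatMoebius ∅ = 1 := by
  rw [flatMoebius, if_pos rfl]

open Classical in
theorem sum_flatMoebius [M.Loopless] (hF : M.IsFlat F) :
    ∑ P ∈ M.flats.filter (fun P => P ⊆ F), M.flatMoebius P = if F = ∅ then 1 else 0 := by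
  have h1 : M.flats.filter (fun P => P ⊆ F) = insert F (M.flats.filter fun P => P ⊂ F) := by
    ext P
    simp only [Finset.mem_filter, mem_flats, Finset.mem_insert]
    constructor
    · rintro ⟨h1, h2⟩
      rcases eq_or_ssubset_of_subset h2 with h | h
      · exact Or.inl h
      · exact Or.inr ⟨h1, h⟩
    · rintro (rfl | h)
      · exact ⟨hF, subset_rfl⟩
      · exact ⟨h.1, h.2.subset⟩
  rw [h1, Finset.sum_insert (by simp)]
  split_ifs with h
  · subst h
    rw [flatMoebius_empty, Finset.sum_eq_zero, add_zero]
    intro P hP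
    rw [Finset.mem_filter] at hP
    exact absurd (Set.empty_subset P) hP.2.not_subset
  · rw [flatMoebius, if_neg h, Finset.sum_attach _ (fun P => M.flatMoebius P)]
    ring

open Classical in
/-- Weisner's theorem for the lattice of flats. -/
theorem sum_flatMoebius_closure_insert [M.Loopless] (hF : M.IsFlat F) (hi : i ∈ F) :
    ∑ P ∈ M.flats.filter (fun P => M.closure (insert i P) = F), M.flatMoebius P = 0 := by
  induction hn : F.ncard using Nat.strong_induction_on generalizing F with
  | _ n ih =>
  subst hn
  have h0 := M.sum_flatMoebius hF
  rw [if_neg (Set.nonempty_iff_ne_empty.1 ⟨i, hi⟩)] at h0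
  -- Group the flats P ⊆ F by cl(P ∪ i), a flat of `F` through `i`. The total is zero, and by
  -- induction so is every fibre other than that of `F`.
  have hfib := Finset.sum_fiberwise_of_maps_to
    (s := M.flats.filter fun P => P ⊆ F) (t := M.flats.filter fun G => G ⊆ F ∧ i ∈ G)
    (g := fun P => M.closure (insert i P)) (by
      intro P hP
      simp only [Finset.mem_filter, mem_flats] at hP ⊢
      exact ⟨M.isFlat_closure _, hF.closure_insert_subset hi hP.2,
        hP.1.insert_subset_closure (hF.subset_ground hi) (Set.mem_insert _ _)⟩) M.flatMoebius
  have hfil : ∀ G ∈ M.flats.filter (fun G => G ⊆ F ∧ i ∈ G),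
      (M.flats.filter fun P => P ⊆ F).filter (fun P => M.closure (insert i P) = G)
        = M.flats.filter (fun P => M.closure (insert i P) = G) := by
    intro G hG
    simp only [Finset.mem_filter, mem_flats] at hG
    ext P
    simp only [Finset.mem_filter, mem_flats]
    constructor
    · exact fun h => ⟨h.1.1, h.2⟩
    · rintro ⟨h1, rfl⟩
      exact ⟨⟨h1, ((Set.subset_insert _ _).trans
        (h1.insert_subset_closure (hF.subset_ground hi))).trans hG.2.1⟩, rfl⟩
  rw [Finset.sum_congr rfl fun G hG => by rw [hfil G hG], h0] at hfib
  rw [Finset.sum_eq_single F] at hfib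
  · exact hfib
  · intro G hG hGF
    simp only [Finset.mem_filter, mem_flats] at hG
    exact ih _ (Set.ncard_lt_ncard (hG.2.1.ssubset_of_ne hGF)
      (M.ground_finite.subset hF.subset_ground)) hG.1 hG.2.2 rfl
  · intro h
    exact absurd (by simp [hF, hi]) h

/-- The absolute value of the Möbius function of the lattice of flats. -/
noncomputable def flatWeight (F : Set α) : ℤ := (-1) ^ M.natRk F * M.flatMoebius F

theorem flatMoebius_eq (F : Set α) : M.flatMoebius F = (-1) ^ M.natRk F * M.flatWeight F := by
  rw [flatWeight, ← mul_assoc, ← mul_pow]; simp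

-- In Weisner's theorem the flats P with cl(P ∪ i) = F are `F` itself and the hyperplanes of `F`
-- missing `i`. These have rank one less, so the signs cancel and a recursion without signs remains.
open Classical in
theorem sum_flatWeight_notMem [M.Loopless] (hF : M.IsFlat F) (hi : i ∈ F)
    (hr : M.natRk F = k + 1) :
    ∑ P ∈ (M.flatsIn F k).filter (fun P => i ∉ P), M.flatWeight P = M.flatWeight F := by
  have h := M.sum_flatMoebius_closure_insert hF hi
  have h1 : M.flats.filter (fun P => M.closure (insert i P) = F)
      = insert F ((M.flatsIn F k).filter fun P => i ∉ P) := by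
    ext P
    simp only [Finset.mem_filter, mem_flats, Finset.mem_insert, mem_flatsIn]
    constructor
    · rintro ⟨hP, hc⟩
      by_cases hiP : i ∈ P
      · left; rw [← hc, Set.insert_eq_of_mem hiP, hP.closure]
      · right
        have h2 := hP.natRk_closure_insert (hF.subset_ground hi) hiP
        have h3 := hP.insert_subset_closure (hF.subset_ground hi)
        rw [hc] at h2 h3
        exact ⟨⟨hP, (Set.subset_insert _ _).trans h3, by omega⟩, hiP⟩
    · rintro (rfl | ⟨⟨hP, hPF, hrP⟩, hiP⟩)
      · exact ⟨hF, by rw [Set.insert_eq_of_mem hi, hF.closure]⟩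
      · exact ⟨hP, hP.closure_insert_eq hF hPF (by omega) hi hiP⟩
  rw [h1, Finset.sum_insert (by simp [hi])] at h
  have h2 : ∑ P ∈ (M.flatsIn F k).filter (fun P => i ∉ P), M.flatMoebius P
      = (-1) ^ k * ∑ P ∈ (M.flatsIn F k).filter (fun P => i ∉ P), M.flatWeight P := by
    rw [Finset.mul_sum]
    refine Finset.sum_congr rfl fun P hP => ?_
    simp only [Finset.mem_filter, mem_flatsIn] at hP
    rw [flatMoebius_eq, hP.1.2.2]
  rw [h2, flatMoebius_eq, hr, pow_succ] at h
  have h3 : ((-1 : ℤ)) ^ k * (∑ P ∈ (M.flatsIn F k).filter (fun P => i ∉ P), M.flatWeight P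
      - M.flatWeight F) = 0 := by linear_combination h
  rcases mul_eq_zero.1 h3 with h | h
  · exact absurd h (pow_ne_zero _ (by norm_num))
  · linarith

/-- Induction on the rank by `sum_flatWeight_notMem`; the sum there is nonempty because, ∅ being a
flat, some hyperplane of `F` misses `i`. -/
theorem flatWeight_pos [M.Loopless] (hF : M.IsFlat F) : 0 < M.flatWeight F := by
  classical
  induction hk : M.natRk F generalizing F with
  | zero =>
    rw [hF.eq_empty_of_natRk_eq_zero hk, flatWeight, natRk_empty, flatMoebius_empty]; norm_num
  | succ k ih =>
    obtain ⟨i, hi⟩ : F.Nonempty := by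
      rw [Set.nonempty_iff_ne_empty]
      rintro rfl
      rw [natRk_empty] at hk
      omega
    rw [← M.sum_flatWeight_notMem hF hi hk]
    refine Finset.sum_pos (fun P hP => ?_) ?_
    · simp only [Finset.mem_filter, mem_flatsIn] at hP
      exact ih hP.1.1 hP.1.2.2
    · obtain ⟨P, h1, h2, h3, h4, -⟩ :=
        hF.exists_isFlat_notMem isFlat_empty_of_loopless (Set.empty_subset _) hi (by simp) hk
      exact ⟨P, by simp [h1, h2, h3, h4]⟩

end Matroid

/-! ### The reverse Cauchy–Schwarz inequality for flats -/

namespace Matroid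

variable {α : Type*} {F G H P : Set α} {i : α} {k : ℕ}

open Classical in
/-- The incidence relation of flats as a real number. -/
noncomputable def flatInc (P F : Set α) : ℝ := if P ⊆ F then 1 else 0

open Classical in
/-- The indicator function of the sets not containing `i`. -/
noncomputable def avoids (i : α) (F : Set α) : ℝ := if i ∈ F then 0 else 1

theorem flatInc_of_subset (h : P ⊆ F) : flatInc P F = 1 := if_pos h
theorem flatInc_of_not_subset (h : ¬ P ⊆ F) : flatInc P F = 0 := if_neg h
theorem avoids_of_mem (h : i ∈ F) : avoids i F = 0 := if_pos h
theorem avoids_of_notMem (h : i ∉ F) : avoids i F = 1 := if_neg h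

theorem flatInc_mul_self (P F : Set α) : flatInc P F * flatInc P F = flatInc P F := by
  by_cases h : P ⊆ F
  · simp [flatInc_of_subset h]
  · simp [flatInc_of_not_subset h]

theorem avoids_mem (i : α) (F : Set α) : 0 ≤ avoids i F ∧ avoids i F ≤ 1 := by
  by_cases h : i ∈ F
  · simp [avoids_of_mem h]
  · simp [avoids_of_notMem h]

variable (M : Matroid α) [M.Finite]

theorem sum_flatsIn_flatInc (h : F ⊆ G) (k : ℕ) (g : Set α → ℝ) :
    ∑ P ∈ M.flatsIn G k, flatInc P F * g P = ∑ P ∈ M.flatsIn F k, g P := by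
  classical
  have : M.flatsIn F k = (M.flatsIn G k).filter (fun P => P ⊆ F) := by
    ext P
    simp only [Finset.mem_filter, mem_flatsIn]
    exact ⟨fun hP => ⟨⟨hP.1, hP.2.1.trans h, hP.2.2⟩, hP.2.1⟩, fun hP => ⟨hP.1.1, hP.2, hP.1.2.2⟩⟩
  rw [this, Finset.sum_filter]
  refine Finset.sum_congr rfl fun P _ => ?_
  by_cases hP : P ⊆ F
  · simp [flatInc_of_subset hP, hP]
  · simp [flatInc_of_not_subset hP, hP]

variable {M}

/-- A flat missing `i` has exactly one cover containing `i`, namely cl(P ∪ i), and only that cover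
contributes. -/
theorem IsFlat.sum_flatInc_mul_avoids (hP : M.IsFlat P) (hr : M.natRk P = k) (hG : M.IsFlat G)
    (hPG : P ⊆ G) (hi : i ∈ G) :
    ∑ F ∈ M.flatsIn G (k + 1), flatInc P F * (avoids i P - avoids i F) = avoids i P := by
  classical
  by_cases hiP : i ∈ P
  · rw [avoids_of_mem hiP]
    refine Finset.sum_eq_zero fun F _ => ?_
    by_cases hPF : P ⊆ F
    · rw [avoids_of_mem (hPF hiP)]; simp
    · rw [flatInc_of_not_subset hPF, zero_mul]
  · have hiE := hG.subset_ground hi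
    have hsub := hP.insert_subset_closure hiE
    rw [Finset.sum_eq_single (M.closure (insert i P))]
    · rw [flatInc_of_subset ((Set.subset_insert _ _).trans hsub),
        avoids_of_mem (hsub (Set.mem_insert _ _))]
      ring
    · intro F hF hne
      rw [mem_flatsIn] at hF
      by_cases hPF : P ⊆ F
      · by_cases hiF : i ∈ F
        · exact absurd (hP.closure_insert_eq hF.1 hPF (by omega) hiF hiP).symm hne
        · rw [avoids_of_notMem hiP, avoids_of_notMem hiF]; simp
      · rw [flatInc_of_not_subset hPF, zero_mul]
    · intro h
      refine absurd ?_ h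
      rw [mem_flatsIn, hP.natRk_closure_insert hiE hiP, hr]
      exact ⟨M.isFlat_closure _, hG.closure_insert_subset hi hPG, rfl⟩

/-- For i ∈ F this is `sum_flatWeight_notMem`; for i ∉ F every flat below `F` misses `i` too and
both sides vanish. -/
theorem IsFlat.sum_flatWeight_mul_avoids [M.Loopless] (hF : M.IsFlat F) (hr : M.natRk F = k + 1)
    (hFG : F ⊆ G) (i : α) :
    ∑ P ∈ M.flatsIn G k, flatInc P F * M.flatWeight P * (avoids i P - avoids i F)
      = (1 - avoids i F) * M.flatWeight F := by
  classical
  simp only [mul_assoc]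
  rw [M.sum_flatsIn_flatInc hFG]
  by_cases hi : i ∈ F
  · rw [← M.sum_flatWeight_notMem hF hi hr, avoids_of_mem hi, Finset.sum_filter]
    push_cast
    rw [sub_zero, one_mul]
    refine Finset.sum_congr rfl fun P _ => ?_
    by_cases hiP : i ∈ P
    · simp [avoids_of_mem hiP, hiP]
    · simp [avoids_of_notMem hiP, hiP]
  · rw [avoids_of_notMem hi, sub_self, zero_mul]
    refine Finset.sum_eq_zero fun P hP => ?_
    rw [mem_flatsIn] at hP
    rw [avoids_of_notMem fun h => hi (hP.2.1 h)]; simp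

/-- The unique-cover identity `sum_flatInc_mul_avoids`, applied inside `H` when i ∈ H and trivial
otherwise. -/
theorem IsFlat.sum_flatInc_mul_flatInc_mul_avoids (hP : M.IsFlat P) (hr : M.natRk P = k)
    (hH : M.IsFlat H) (hHG : H ⊆ G) (i : α) :
    ∑ F ∈ M.flatsIn G (k + 1), flatInc P F * flatInc F H * (avoids i P - avoids i F)
      = flatInc P H * (avoids i P - avoids i H) := by
  have h1 : ∀ F, flatInc P F * flatInc F H * (avoids i P - avoids i F)
      = flatInc F H * (flatInc P F * (avoids i P - avoids i F)) := fun F => by ring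
  rw [Finset.sum_congr rfl fun F _ => h1 F, M.sum_flatsIn_flatInc hHG]
  by_cases hPH : P ⊆ H
  · by_cases hi : i ∈ H
    · rw [hP.sum_flatInc_mul_avoids hr hH hPH hi, flatInc_of_subset hPH, avoids_of_mem hi]; ring
    · rw [avoids_of_notMem hi, avoids_of_notMem fun h => hi (hPH h), sub_self, mul_zero]
      refine Finset.sum_eq_zero fun F hF => ?_
      rw [mem_flatsIn] at hF
      rw [avoids_of_notMem fun h => hi (hF.2.1 h)]; simp
  · rw [flatInc_of_not_subset hPH, zero_mul]
    refine Finset.sum_eq_zero fun F hF => ?_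
    rw [mem_flatsIn] at hF
    rw [flatInc_of_not_subset fun h => hPH (h.trans hF.2.1), zero_mul]

/-- Two distinct covers of a flat have exactly one common cover. -/
theorem IsFlat.sum_flatInc_mul_flatInc {F' : Set α} (hP : M.IsFlat P) (hr : M.natRk P = k)
    (hF : F ∈ M.flatsIn G (k + 1)) (hF' : F' ∈ M.flatsIn G (k + 1)) (hG : M.IsFlat G)
    (hne : F ≠ F') (hPF : P ⊆ F) (hPF' : P ⊆ F') :
    ∑ H ∈ M.flatsIn G (k + 2), flatInc F H * flatInc F' H = 1 := by
  classical
  rw [mem_flatsIn] at hF hF'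
  obtain ⟨i, hi', hi⟩ : ∃ i ∈ F', i ∉ F := by
    by_contra! h
    exact hne (hF'.1.eq_of_natRk_le hF.1 h (by omega)).symm
  have hiE := hF'.1.subset_ground hi'
  have hsub := hF.1.insert_subset_closure hiE
  have hF'eq := hP.closure_insert_eq hF'.1 hPF' (by omega) hi' (fun h => hi (hPF h))
  -- Since F' = cl(P ∪ i), a flat above `F` contains F' exactly when it contains `i`; the common
  -- cover is therefore cl(F ∪ i).
  rw [Finset.sum_eq_single (M.closure (insert i F))]
  · rw [flatInc_of_subset ((Set.subset_insert _ _).trans hsub), flatInc_of_subset, one_mul]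
    rw [← hF'eq]
    exact M.closure_subset_closure (Set.insert_subset_insert hPF)
  · intro H hH hHne
    rw [mem_flatsIn] at hH
    by_cases hFH : F ⊆ H
    · rw [flatInc_of_not_subset (P := F'), mul_zero]
      intro hF'H
      exact hHne (hF.1.closure_insert_eq hH.1 hFH (by omega) (hF'H hi') hi).symm
    · rw [flatInc_of_not_subset hFH, zero_mul]
  · intro h
    refine absurd ?_ h
    rw [mem_flatsIn, hF.1.natRk_closure_insert hiE hi, hF.2.2]
    exact ⟨M.isFlat_closure _, hG.closure_insert_subset (hF'.2.1 hi') hF.2.1, rfl⟩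

/-- The incidence graph of the flats of ranks `k` and `k + 1` is connected. -/
theorem IsFlat.eq_of_forall_cover (hG : M.IsFlat G) (gP gF : Set α → ℝ)
    (h : ∀ P ∈ M.flatsIn G k, ∀ F ∈ M.flatsIn G (k + 1), P ⊆ F → gP P = gF F)
    {P P' : Set α} (hP : P ∈ M.flatsIn G k) (hP' : P' ∈ M.flatsIn G k) : gP P = gP P' := by
  induction hn : (P' \ P).ncard using Nat.strong_induction_on generalizing P with
  | _ n ih =>
  subst hn
  rw [mem_flatsIn] at hP hP'
  rcases eq_or_ne P P' with rfl | hne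
  · rfl
  obtain ⟨i, hi', hi⟩ : ∃ i ∈ P', i ∉ P := by
    by_contra! h
    exact hne (hP'.1.eq_of_natRk_le hP.1 h (by omega)).symm
  obtain ⟨j, hj, hj'⟩ : ∃ j ∈ P, j ∉ P' := by
    by_contra! h
    exact hne (hP.1.eq_of_natRk_le hP'.1 h (by omega))
  have hiE := hP'.1.subset_ground hi'
  have hk : 0 < k := by
    rcases Nat.eq_zero_or_pos k with rfl | h0
    · have := (hP.1.inter hP'.1).eq_of_natRk_le hP.1 Set.inter_subset_left (by omega)
      exact absurd (this.ge hj).2 hj'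
    · exact h0
  -- Basis exchange for flats: replace P by cl(Q ∪ i), where Q is a hyperplane of P containing P ∩
  -- P'. Both lie under cl(P ∪ i), and the new flat misses fewer points of P'.
  obtain ⟨Q, hQ, hQP, hrQ, hjQ, hQi⟩ := hP.1.exists_isFlat_notMem (hP.1.inter hP'.1)
    Set.inter_subset_left hj (fun hc => hj' hc.2) (k := k - 1) (by omega)
  have hiQ : i ∉ Q := fun hc => hi (hQP hc)
  have hsub := hQ.insert_subset_closure hiE
  have hsubP := hP.1.insert_subset_closure hiE
  have hP'' : M.closure (insert i Q) ∈ M.flatsIn G k := by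
    rw [mem_flatsIn, hQ.natRk_closure_insert hiE hiQ]
    exact ⟨M.isFlat_closure _, hG.closure_insert_subset (hP'.2.1 hi') (hQP.trans hP.2.1), by omega⟩
  have hF : M.closure (insert i P) ∈ M.flatsIn G (k + 1) := by
    rw [mem_flatsIn, hP.1.natRk_closure_insert hiE hi]
    exact ⟨M.isFlat_closure _, hG.closure_insert_subset (hP'.2.1 hi') hP.2.1, by omega⟩
  have h1 := h P (by rw [mem_flatsIn]; exact hP) _ hF ((Set.subset_insert _ _).trans hsubP)
  have h2 := h _ hP'' _ hF (M.closure_subset_closure (Set.insert_subset_insert hQP))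
  rw [h1, ← h2]
  refine ih _ (Set.ncard_lt_ncard ?_ ((M.ground_finite.subset hP'.1.subset_ground).subset
    Set.sdiff_subset)) hP'' rfl
  refine (Set.ssubset_iff_of_subset ?_).2 ⟨i, ⟨hi', hi⟩, fun hc => hc.2 (hsub (Set.mem_insert _ _))⟩
  intro x hx
  exact ⟨hx.1, fun hxP => hx.2 (hsub (Set.mem_insert_of_mem _ (hQi ⟨hxP, hx.1⟩)))⟩

theorem IsFlat.exists_mem_flatsIn [M.Loopless] (hF : M.IsFlat F) (hr : M.natRk F = k + 1)
    (hFG : F ⊆ G) : ∃ P ∈ M.flatsIn G k, P ⊆ F := by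
  obtain ⟨i, hi⟩ : F.Nonempty := by
    rw [Set.nonempty_iff_ne_empty]
    rintro rfl
    rw [natRk_empty] at hr
    omega
  obtain ⟨P, h1, h2, h3, -, -⟩ :=
    hF.exists_isFlat_notMem isFlat_empty_of_loopless (Set.empty_subset _) hi (by simp) hr
  exact ⟨P, by simp [h1, h2.trans hFG, h3], h2⟩

variable (M)

/-- The reverse Cauchy–Schwarz inequality for the flats of ranks `k` and `k + 1` contained
in `G`. -/
def FlatInequality (G : Set α) (i : α) (k : ℕ) : Prop :=
  ∀ Y Z : Set α → ℝ, (∑ H ∈ M.flatsIn G (k + 1), M.flatWeight H * avoids i H) *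
    (∑ F ∈ M.flatsIn G k, M.flatWeight F * Y F ^ 2
      + ∑ H ∈ M.flatsIn G (k + 1), M.flatWeight H * Z H ^ 2
      - ∑ F ∈ M.flatsIn G k, ∑ H ∈ M.flatsIn G (k + 1),
          flatInc F H * M.flatWeight F * (Y F - Z H) ^ 2)
      ≤ (∑ H ∈ M.flatsIn G (k + 1), M.flatWeight H * Z H) ^ 2

variable {M}

/-- The flats of three consecutive ranks contained in a given flat. -/
noncomputable def weightedLevels [M.Loopless] (hG : M.IsFlat G) (hi : i ∈ G) (k : ℕ)
    (ih : ∀ H ∈ M.flatsIn G (k + 2), ∀ j ∈ H, M.FlatInequality H j k) :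
    WeightedLevels (M.flatsIn G k) (M.flatsIn G (k + 1)) (M.flatsIn G (k + 2)) where
  a P F := flatInc P.1 F.1
  b F H := flatInc F.1 H.1
  c P H := flatInc P.1 H.1
  wP P := M.flatWeight P.1
  wF F := M.flatWeight F.1
  wH H := M.flatWeight H.1
  p P := avoids i P.1
  f F := avoids i F.1
  h H := avoids i H.1
  a_mul_self _ _ := flatInc_mul_self _ _
  b_mul_self _ _ := flatInc_mul_self _ _
  c_nonneg _ _ := by rw [← flatInc_mul_self]; exact mul_self_nonneg _
  a_mul_b_mul_c P F H := by
    by_cases h1 : P.1 ⊆ F.1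
    · by_cases h2 : F.1 ⊆ H.1
      · rw [flatInc_of_subset (h1.trans h2), mul_one]
      · rw [flatInc_of_not_subset h2]; ring
    · rw [flatInc_of_not_subset h1]; ring
  wP_pos P := by exact_mod_cast M.flatWeight_pos ((M.mem_flatsIn).1 P.2).1
  wF_pos F := by exact_mod_cast M.flatWeight_pos ((M.mem_flatsIn).1 F.2).1
  wH_pos H := by exact_mod_cast M.flatWeight_pos ((M.mem_flatsIn).1 H.2).1
  p_mem _ := avoids_mem _ _
  f_mem _ := avoids_mem _ _
  h_mem _ := avoids_mem _ _
  sum_a P := by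
    have hP := (M.mem_flatsIn).1 P.2
    rw [Finset.sum_coe_sort (M.flatsIn G (k + 1))
      (fun F => flatInc P.1 F * (avoids i P.1 - avoids i F))]
    exact hP.1.sum_flatInc_mul_avoids hP.2.2 hG hP.2.1 hi
  sum_b F := by
    have hF := (M.mem_flatsIn).1 F.2
    rw [Finset.sum_coe_sort (M.flatsIn G (k + 2))
      (fun H => flatInc F.1 H * (avoids i F.1 - avoids i H))]
    exact hF.1.sum_flatInc_mul_avoids hF.2.2 hG hF.2.1 hi
  sum_wP F := by
    have hF := (M.mem_flatsIn).1 F.2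
    rw [Finset.sum_coe_sort (M.flatsIn G k)
      (fun P => flatInc P F.1 * M.flatWeight P * (avoids i P - avoids i F.1))]
    exact hF.1.sum_flatWeight_mul_avoids hF.2.2 hF.2.1 i
  sum_wF H := by
    have hH := (M.mem_flatsIn).1 H.2
    rw [Finset.sum_coe_sort (M.flatsIn G (k + 1))
      (fun F => flatInc F H.1 * M.flatWeight F * (avoids i F - avoids i H.1))]
    exact hH.1.sum_flatWeight_mul_avoids hH.2.2 hH.2.1 i
  sum_a_b P H := by
    have hP := (M.mem_flatsIn).1 P.2
    have hH := (M.mem_flatsIn).1 H.2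
    rw [Finset.sum_coe_sort (M.flatsIn G (k + 1))
      (fun F => flatInc P.1 F * flatInc F H.1 * (avoids i P.1 - avoids i F))]
    exact hP.1.sum_flatInc_mul_flatInc_mul_avoids hP.2.2 hH.1 hH.2.1 i
  sum_b_b P F F' hne := by
    have hP := (M.mem_flatsIn).1 P.2
    by_cases h1 : P.1 ⊆ F.1
    · by_cases h2 : P.1 ⊆ F'.1
      · rw [Finset.sum_coe_sort (M.flatsIn G (k + 2)) (fun H => flatInc F.1 H * flatInc F'.1 H),
          hP.1.sum_flatInc_mul_flatInc hP.2.2 F.2 F'.2 hG (fun h => hne (Subtype.ext h)) h1 h2,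
          mul_one]
      · rw [flatInc_of_not_subset h2]; ring
    · rw [flatInc_of_not_subset h1]; ring
  connected gP gF gH h1 h2 := by
    have hPeq : ∀ P P', gP P = gP P' := by
      intro P P'
      have := hG.eq_of_forall_cover (k := k) (Function.extend Subtype.val gP 0)
        (Function.extend Subtype.val gF 0) (by
          intro P hP F hF hPF
          have e1 := Subtype.val_injective.extend_apply gP 0 ⟨P, hP⟩
          have e2 := Subtype.val_injective.extend_apply gF 0 ⟨F, hF⟩
          dsimp only at e1 e2
          rw [e1, e2]
          exact h1 ⟨P, hP⟩ ⟨F, hF⟩ (flatInc_of_subset hPF)) P.2 P'.2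
      rwa [Subtype.val_injective.extend_apply, Subtype.val_injective.extend_apply] at this
    have hF : ∀ F, ∃ P, gP P = gF F := by
      intro F
      have hF := (M.mem_flatsIn).1 F.2
      obtain ⟨P, hP, hPF⟩ := hF.1.exists_mem_flatsIn hF.2.2 hF.2.1
      exact ⟨⟨P, hP⟩, h1 _ _ (flatInc_of_subset hPF)⟩
    have hH : ∀ H, ∃ P, gP P = gH H := by
      intro H
      have hH := (M.mem_flatsIn).1 H.2
      obtain ⟨F, hF', hFH⟩ := hH.1.exists_mem_flatsIn hH.2.2 hH.2.1
      obtain ⟨P, hP⟩ := hF ⟨F, hF'⟩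
      exact ⟨P, hP.trans (h2 _ _ (flatInc_of_subset hFH))⟩
    rcases isEmpty_or_nonempty (M.flatsIn G k) with he | ⟨⟨P0⟩⟩
    · exact ⟨0, fun P => he.elim P, fun F => he.elim (hF F).choose, fun H => he.elim (hH H).choose⟩
    · refine ⟨gP P0, fun P => hPeq _ _, fun F => ?_, fun H => ?_⟩
      · obtain ⟨P, hP⟩ := hF F
        rw [← hP, hPeq P P0]
      · obtain ⟨P, hP⟩ := hH H
        rw [← hP, hPeq P P0]
  local_ineq H X Y := by
    classical
    have hH := (M.mem_flatsIn).1 H.2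
    -- Any point j of H serves in the induction hypothesis: the weights of the hyperplanes of H
    -- missing j sum to the weight of H, whatever j is.
    obtain ⟨j, hj⟩ : (H.1).Nonempty := by
      rw [Set.nonempty_iff_ne_empty]
      intro h0
      rw [h0, natRk_empty] at hH
      omega
    set X' : Set α → ℝ := Function.extend Subtype.val X 0
    set Y' : Set α → ℝ := Function.extend Subtype.val Y 0
    have hX : ∀ P, X P = X' P.1 := fun P => (Subtype.val_injective.extend_apply X 0 P).symm
    have hY : ∀ F, Y F = Y' F.1 := fun F => (Subtype.val_injective.extend_apply Y 0 F).symm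
    simp only [hX, hY]
    have key := ih H.1 H.2 j hj X' Y'
    have hW : ∑ F ∈ M.flatsIn H.1 (k + 1), (M.flatWeight F : ℝ) * avoids j F
        = M.flatWeight H.1 := by
      rw [← M.sum_flatWeight_notMem hH.1 hj hH.2.2, Finset.sum_filter]
      push_cast
      refine Finset.sum_congr rfl fun F _ => ?_
      by_cases hjF : j ∈ F
      · simp [avoids_of_mem hjF, hjF]
      · simp [avoids_of_notMem hjF, hjF]
    rw [hW] at key
    have e1 : ∑ P : M.flatsIn G k, flatInc P.1 H.1 * (M.flatWeight P.1 : ℝ) * X' P.1 ^ 2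
        = ∑ P ∈ M.flatsIn H.1 k, (M.flatWeight P : ℝ) * X' P ^ 2 := by
      rw [Finset.sum_coe_sort (M.flatsIn G k)
        (fun P => flatInc P H.1 * (M.flatWeight P : ℝ) * X' P ^ 2)]
      simp only [mul_assoc]
      rw [M.sum_flatsIn_flatInc hH.2.1]
    have e2 : ∑ F : M.flatsIn G (k + 1), flatInc F.1 H.1 * (M.flatWeight F.1 : ℝ) * Y' F.1 ^ 2
        = ∑ F ∈ M.flatsIn H.1 (k + 1), (M.flatWeight F : ℝ) * Y' F ^ 2 := by
      rw [Finset.sum_coe_sort (M.flatsIn G (k + 1))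
        (fun P => flatInc P H.1 * (M.flatWeight P : ℝ) * Y' P ^ 2)]
      simp only [mul_assoc]
      rw [M.sum_flatsIn_flatInc hH.2.1]
    have e3 : ∑ F : M.flatsIn G (k + 1), flatInc F.1 H.1 * (M.flatWeight F.1 : ℝ) * Y' F.1
        = ∑ F ∈ M.flatsIn H.1 (k + 1), (M.flatWeight F : ℝ) * Y' F := by
      rw [Finset.sum_coe_sort (M.flatsIn G (k + 1))
        (fun P => flatInc P H.1 * (M.flatWeight P : ℝ) * Y' P)]
      simp only [mul_assoc]
      rw [M.sum_flatsIn_flatInc hH.2.1]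
    have e4 : ∑ P : M.flatsIn G k, ∑ F : M.flatsIn G (k + 1),
          flatInc P.1 F.1 * flatInc F.1 H.1 * (M.flatWeight P.1 : ℝ) * (X' P.1 - Y' F.1) ^ 2
        = ∑ P ∈ M.flatsIn H.1 k, ∑ F ∈ M.flatsIn H.1 (k + 1),
          flatInc P F * (M.flatWeight P : ℝ) * (X' P - Y' F) ^ 2 := by
      have i1 : ∀ P : M.flatsIn G k, ∑ F : M.flatsIn G (k + 1),
          flatInc P.1 F.1 * flatInc F.1 H.1 * (M.flatWeight P.1 : ℝ) * (X' P.1 - Y' F.1) ^ 2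
          = flatInc P.1 H.1 * ∑ F ∈ M.flatsIn H.1 (k + 1),
            flatInc P.1 F * (M.flatWeight P.1 : ℝ) * (X' P.1 - Y' F) ^ 2 := by
        intro P
        rw [Finset.sum_coe_sort (M.flatsIn G (k + 1)) (fun F =>
          flatInc P.1 F * flatInc F H.1 * (M.flatWeight P.1 : ℝ) * (X' P.1 - Y' F) ^ 2)]
        rw [← M.sum_flatsIn_flatInc hH.2.1, Finset.mul_sum]
        refine Finset.sum_congr rfl fun F _ => ?_
        by_cases h1 : P.1 ⊆ F
        · by_cases h2 : F ⊆ H.1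
          · rw [flatInc_of_subset (h1.trans h2)]; ring
          · rw [flatInc_of_not_subset h2]; ring
        · rw [flatInc_of_not_subset h1]; ring
      rw [Finset.sum_congr rfl fun P _ => i1 P, Finset.sum_coe_sort (M.flatsIn G k)
        (fun P => flatInc P H.1 * ∑ F ∈ M.flatsIn H.1 (k + 1),
            flatInc P F * (M.flatWeight P : ℝ) * (X' P - Y' F) ^ 2),
        M.sum_flatsIn_flatInc hH.2.1]
    rw [e1, e2, e3, e4]
    exact key

/-- Induction on `k`. The inequality at level `k` for the flats of rank k + 2 in `G` is the local
inequality of `weightedLevels`, and `upperForm_mul_le` then yields level k + 1 for `G`. -/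
theorem IsFlat.flatInequality [M.Loopless] (hG : M.IsFlat G) (hi : i ∈ G)
    (hr : k + 2 ≤ M.natRk G) : M.FlatInequality G i k := by
  classical
  induction k generalizing G i with
  | zero =>
    intro Y Z
    have h0 : M.flatsIn G 0 = {∅} := by
      ext P
      rw [mem_flatsIn, Finset.mem_singleton]
      constructor
      · exact fun h => h.1.eq_empty_of_natRk_eq_zero h.2.2
      · rintro rfl
        exact ⟨isFlat_empty_of_loopless, Set.empty_subset _, natRk_empty M⟩
    have hw0 : M.flatWeight ∅ = 1 := by
      rw [flatWeight, natRk_empty, flatMoebius_empty]; norm_num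
    have hw : ∀ F ∈ M.flatsIn G (0 + 1), M.flatWeight F = 1 := by
      intro F hF
      rw [mem_flatsIn] at hF
      obtain ⟨j, hj⟩ : F.Nonempty := by
        rw [Set.nonempty_iff_ne_empty]
        rintro rfl
        rw [natRk_empty] at hF
        omega
      rw [← M.sum_flatWeight_notMem hF.1 hj hF.2.2]
      have : (M.flatsIn F 0).filter (fun P => j ∉ P) = {∅} := by
        ext P
        rw [Finset.mem_filter, mem_flatsIn, Finset.mem_singleton]
        constructor
        · exact fun h => h.1.1.eq_empty_of_natRk_eq_zero h.1.2.2
        · rintro rfl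
          exact ⟨⟨isFlat_empty_of_loopless, Set.empty_subset _, natRk_empty M⟩, by simp⟩
      rw [this, Finset.sum_singleton, hw0]
    -- Exactly one of the n atoms of `G` contains `i`, and all atoms have weight 1, so the leading
    -- factor is n − 1.
    have hav := isFlat_empty_of_loopless.sum_flatInc_mul_avoids (natRk_empty M) hG
      (Set.empty_subset _) hi
    simp only [flatInc_of_subset (Set.empty_subset _), one_mul, avoids_of_notMem
      (Set.notMem_empty i), Finset.sum_sub_distrib, Finset.sum_const, nsmul_eq_mul, mul_one] at hav
    have hW : ∑ H ∈ M.flatsIn G (0 + 1), (M.flatWeight H : ℝ) * avoids i H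
        = (M.flatsIn G (0 + 1)).card - 1 := by
      rw [Finset.sum_congr rfl fun F hF => by rw [hw F hF, Int.cast_one, one_mul]]
      linarith
    set n : ℝ := ((M.flatsIn G (0 + 1)).card : ℝ) with hn
    have hZ2 : ∑ H ∈ M.flatsIn G (0 + 1), (M.flatWeight H : ℝ) * Z H ^ 2
        = ∑ H ∈ M.flatsIn G (0 + 1), Z H ^ 2 :=
      Finset.sum_congr rfl fun F hF => by rw [hw F hF, Int.cast_one, one_mul]
    have hZ1 : ∑ H ∈ M.flatsIn G (0 + 1), (M.flatWeight H : ℝ) * Z H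
        = ∑ H ∈ M.flatsIn G (0 + 1), Z H :=
      Finset.sum_congr rfl fun F hF => by rw [hw F hF, Int.cast_one, one_mul]
    have hS : ∑ H ∈ M.flatsIn G (0 + 1), (Y ∅ - Z H) ^ 2
        = n * Y ∅ ^ 2 - 2 * Y ∅ * ∑ H ∈ M.flatsIn G (0 + 1), Z H
          + ∑ H ∈ M.flatsIn G (0 + 1), Z H ^ 2 := by
      rw [hn, ← nsmul_eq_mul, ← Finset.sum_const, Finset.mul_sum, ← Finset.sum_sub_distrib,
        ← Finset.sum_add_distrib]
      exact Finset.sum_congr rfl fun F _ => by ring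
    rw [hW, hZ1, hZ2, h0, Finset.sum_singleton, Finset.sum_singleton, hw0]
    simp only [flatInc_of_subset (Set.empty_subset _), Int.cast_one, one_mul]
    rw [hS]
    -- The form equals 2 y S − (n − 1) y² with y = Y ∅ and S = ∑ Z, so the inequality is (S − (n −
    -- 1) y)² ≥ 0.
    nlinarith [sq_nonneg (∑ H ∈ M.flatsIn G (0 + 1), Z H - (n - 1) * Y ∅)]
  | succ k ih =>
    intro Y Z
    have ih' : ∀ H ∈ M.flatsIn G (k + 2), ∀ j ∈ H, M.FlatInequality H j k := by
      intro H hH j hj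
      rw [mem_flatsIn] at hH
      exact ih hH.1 hj hH.2.2.ge
    have key := (weightedLevels hG hi k ih').upperForm_mul_le (fun F => Y F.1) (fun H => Z H.1)
    simp only [weightedLevels, WeightedLevels.upperForm] at key
    simp only [Finset.sum_coe_sort (M.flatsIn G (k + 2))
        (fun H => (M.flatWeight H : ℝ) * avoids i H),
      Finset.sum_coe_sort (M.flatsIn G (k + 1)) (fun F => (M.flatWeight F : ℝ) * Y F ^ 2),
      Finset.sum_coe_sort (M.flatsIn G (k + 2)) (fun F => (M.flatWeight F : ℝ) * Z F ^ 2),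
      Finset.sum_coe_sort (M.flatsIn G (k + 2)) (fun F => (M.flatWeight F : ℝ) * Z F)] at key
    have e : ∑ F : M.flatsIn G (k + 1), ∑ H : M.flatsIn G (k + 2),
          flatInc F.1 H.1 * (M.flatWeight F.1 : ℝ) * (Y F.1 - Z H.1) ^ 2
        = ∑ F ∈ M.flatsIn G (k + 1), ∑ H ∈ M.flatsIn G (k + 2),
          flatInc F H * (M.flatWeight F : ℝ) * (Y F - Z H) ^ 2 := by
      rw [← Finset.sum_coe_sort (M.flatsIn G (k + 1))]
      exact Finset.sum_congr rfl fun F _ => Finset.sum_coe_sort (M.flatsIn G (k + 2))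
        (fun H => flatInc F.1 H * (M.flatWeight F.1 : ℝ) * (Y F.1 - Z H) ^ 2)
    rw [e] at key
    exact key

end Matroid

/-! ### Coefficients of the characteristic polynomial -/

namespace Matroid

variable {α : Type*} (M : Matroid α) {F : Set α} {i : α} {k : ℕ}

theorem exists_mem_ground (h : 1 ≤ M.natRank) : ∃ i, i ∈ M.E := by
  by_contra! hE
  have : M.E = ∅ := Set.eq_empty_of_forall_notMem hE
  rw [← natRk_ground, this, natRk_empty] at h
  omega

variable [M.Finite]

theorem natRank_contract (hF : F ⊆ M.E) : (M ／ F).natRank + M.natRk F = M.natRank := by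
  obtain ⟨I, hI⟩ := M.exists_isBasis F hF
  obtain ⟨J, hJ, hIJ⟩ := hI.indep.exists_isBase_superset
  have hJE : M.IsBasis J M.E := hJ.isBasis_ground
  have h1 := hI.contract_sdiff_isBasis_sdiff hJE hIJ
  have hfin : J.Finite := M.ground_finite.subset hJ.subset_ground
  have h2 : (M ／ F).eRank = (J \ I).encard := by
    rw [hI.contract_eq_contract_delete, delete_eq_restrict, eRank_restrict, contract_ground,
      Set.sdiff_sdiff, Set.union_sdiff_cancel hI.subset, h1.eRk_eq_encard]
  have h3 : M.natRk F = I.ncard := by rw [natRk, hI.eRk_eq_encard]; rfl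
  have h4 : M.natRank = J.ncard := by rw [natRank, ← hJ.encard_eq_eRank]; rfl
  have h5 : (M ／ F).natRank = (J \ I).ncard := by rw [natRank, h2]; rfl
  rw [h3, h4, h5]
  exact Set.ncard_sdiff_add_ncard_of_subset hIJ hfin

open Classical in
/-- Möbius inversion over the lattice of flats. -/
theorem eq_sum_flatMoebius_mul [M.Loopless] {R : Type*} [CommRing R] (a b : Set α → R)
    (h : ∀ F ∈ M.flats, ∑ G ∈ M.flats.filter (fun G => F ⊆ G), a G = b F) :
    a ∅ = ∑ F ∈ M.flats, (M.flatMoebius F : R) * b F := by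
  have h1 : ∑ F ∈ M.flats, (M.flatMoebius F : R) * b F
      = ∑ F ∈ M.flats, ∑ G ∈ M.flats, if F ⊆ G then (M.flatMoebius F : R) * a G else 0 := by
    refine Finset.sum_congr rfl fun F hF => ?_
    rw [← h F hF, Finset.mul_sum, Finset.sum_filter]
  rw [h1, Finset.sum_comm]
  have h2 : ∀ G ∈ M.flats, (∑ F ∈ M.flats, if F ⊆ G then (M.flatMoebius F : R) * a G else 0)
      = if G = ∅ then a G else 0 := by
    intro G hG
    rw [mem_flats] at hG
    rw [← Finset.sum_filter, ← Finset.sum_mul, ← Int.cast_sum, M.sum_flatMoebius hG]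
    split_ifs <;> simp
  rw [Finset.sum_congr rfl h2, Finset.sum_ite_eq' M.flats ∅ a, if_pos]
  rw [mem_flats]
  exact isFlat_empty_of_loopless

-- The defining recursion for `M ／ F`, transported along the bijection G ↦ G \ F from the flats of
-- `M` above `F` to the flats of the contraction. It is the input to Möbius inversion.
open Classical in
theorem sum_charPoly_contract (hF : M.IsFlat F) :
    ∑ G ∈ M.flats.filter (fun G => F ⊆ G), (M ／ G).charPoly = X ^ (M.natRank - M.natRk F) := by
  have hr := M.natRank_contract hF.subset_ground
  rw [show M.natRank - M.natRk F = (M ／ F).natRank by omega, ← finsum_charPoly (M ／ F)]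
  have hcong : ∀ (N N' : Matroid α) [N.Finite] [N'.Finite], N = N' → N.charPoly = N'.charPoly := by
    rintro N N' _ _ rfl; rfl
  rw [finsum_subtype_eq_finsum_cond (f := fun G => ((M ／ F) ／ G).charPoly) (fun G => (M ／ F).IsFlat G)]
  have hfs : ∀ G, G ∈ (M ／ F).flats ↔ (M ／ F).IsFlat G := fun G => mem_flats _
  rw [show (∑ᶠ (G : Set α) (_ : (M ／ F).IsFlat G), ((M ／ F) ／ G).charPoly)
    = ∑ᶠ (G : Set α) (_ : G ∈ (M ／ F).flats), ((M ／ F) ／ G).charPoly by simp only [hfs],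
    finsum_mem_finset_eq_sum]
  refine Finset.sum_bij' (fun G _ => G \ F) (fun G _ => G ∪ F) ?_ ?_ ?_ ?_ ?_
  · intro G hG
    rw [Finset.mem_filter, mem_flats] at hG
    rw [mem_flats, isFlat_iff_closure_eq, contract_closure_eq, Set.sdiff_union_of_subset hG.2,
      hG.1.closure]
  · intro G hG
    rw [mem_flats] at hG
    have h1 := hG.closure
    rw [contract_closure_eq] at h1
    rw [Finset.mem_filter, mem_flats, isFlat_iff_closure_eq]
    refine ⟨?_, Set.subset_union_right⟩
    conv_rhs => rw [← h1]
    rw [Set.sdiff_union_of_subset]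
    have := M.closure_subset_closure (Set.subset_union_right (s := G) (t := F))
    rwa [hF.closure] at this
  · intro G hG
    rw [Finset.mem_filter] at hG
    exact Set.sdiff_union_of_subset hG.2
  · intro G hG
    rw [mem_flats] at hG
    have hd : Disjoint G F := (Set.subset_sdiff.1 hG.subset_ground).2
    simpa using hd
  · intro G hG
    rw [Finset.mem_filter] at hG
    refine hcong _ _ ?_
    rw [contract_contract, Set.union_sdiff_cancel hG.2]

/-- The characteristic polynomial as the generating function of the Möbius function. -/
theorem charPoly_eq_sum [M.Loopless] :
    M.charPoly = ∑ F ∈ M.flats, (M.flatMoebius F : ℤ[X]) * X ^ (M.natRank - M.natRk F) := by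
  classical
  have hcong : ∀ (N N' : Matroid α) [N.Finite] [N'.Finite], N = N' → N.charPoly = N'.charPoly := by
    rintro N N' _ _ rfl; rfl
  have h := M.eq_sum_flatMoebius_mul (fun G => (M ／ G).charPoly)
    (fun F => X ^ (M.natRank - M.natRk F))
    (fun F hF => M.sum_charPoly_contract ((mem_flats M).1 hF))
  rw [← h]
  exact hcong _ _ (contract_empty M).symm

theorem natRk_le_natRank (X : Set α) : M.natRk X ≤ M.natRank := by
  have := M.eRk_le_eRank X
  have h2 : M.eRank ≠ ⊤ := by
    rw [← eRk_ground]; exact eRk_ne_top_iff.2 (M.isRkFinite_set _)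
  exact ENat.toNat_le_toNat this h2

variable {M} in
theorem IsFlat.natRk_lt_natRank (hF : M.IsFlat F) (hi : i ∈ M.E) (hiF : i ∉ F) :
    M.natRk F < M.natRank := by
  have := hF.natRk_closure_insert hi hiF
  have h2 := M.natRk_le_natRank (M.closure (insert i F))
  omega

open Classical in
/-- The generating function of the Möbius function over the flats avoiding a point. -/
noncomputable def avoidingPoly (i : α) : ℤ[X] :=
  ∑ F ∈ M.flats.filter (fun F => i ∉ F), (M.flatMoebius F : ℤ[X]) * X ^ (M.natRank - 1 - M.natRk F)

/-- The flats avoiding `i` contribute `X * avoidingPoly`. By Weisner's theorem each flat through `i`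
can be traded for the avoiding flats P with that closure, with opposite sign and rank one less, so
the remaining flats contribute `-avoidingPoly`. -/
theorem charPoly_eq_mul_avoidingPoly [M.Loopless] (hi : i ∈ M.E) :
    M.charPoly = (X - 1) * M.avoidingPoly i := by
  classical
  rw [charPoly_eq_sum, ← Finset.sum_filter_add_sum_filter_not M.flats (fun F => i ∉ F)]
  have h1 : ∑ F ∈ M.flats.filter (fun F => i ∉ F),
      (M.flatMoebius F : ℤ[X]) * X ^ (M.natRank - M.natRk F) = X * M.avoidingPoly i := by
    rw [avoidingPoly, Finset.mul_sum]
    refine Finset.sum_congr rfl fun F hF => ?_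
    rw [Finset.mem_filter, mem_flats] at hF
    have := hF.1.natRk_lt_natRank hi hF.2
    rw [show M.natRank - M.natRk F = M.natRank - 1 - M.natRk F + 1 by omega, pow_succ]
    ring
  have h2 : ∑ F ∈ M.flats.filter (fun F => ¬ i ∉ F),
      (M.flatMoebius F : ℤ[X]) * X ^ (M.natRank - M.natRk F) = - M.avoidingPoly i := by
    rw [avoidingPoly, ← Finset.sum_fiberwise_of_maps_to
      (s := M.flats.filter fun F => i ∉ F) (t := M.flats.filter fun F => ¬ i ∉ F)
      (g := fun P => M.closure (insert i P)), ← Finset.sum_neg_distrib]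
    · refine Finset.sum_congr rfl fun F hF => ?_
      rw [Finset.mem_filter, mem_flats, not_not] at hF
      have hw := M.sum_flatMoebius_closure_insert hF.1 hF.2
      have hset : M.flats.filter (fun P => M.closure (insert i P) = F)
          = insert F ((M.flats.filter (fun P => i ∉ P)).filter
            fun P => M.closure (insert i P) = F) := by
        ext P
        simp only [Finset.mem_filter, mem_flats, Finset.mem_insert]
        constructor
        · rintro ⟨hP, hc⟩
          by_cases hiP : i ∈ P
          · left; rw [← hc, Set.insert_eq_of_mem hiP, hP.closure]
          · exact Or.inr ⟨⟨hP, hiP⟩, hc⟩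
        · rintro (rfl | h)
          · exact ⟨hF.1, by rw [Set.insert_eq_of_mem hF.2, hF.1.closure]⟩
          · exact ⟨h.1.1, h.2⟩
      rw [hset, Finset.sum_insert (by simp [hF.2])] at hw
      rw [eq_neg_of_add_eq_zero_left hw, Int.cast_neg, Int.cast_sum, neg_mul, Finset.sum_mul]
      refine congrArg Neg.neg (Finset.sum_congr rfl fun P hP => ?_)
      rw [Finset.mem_filter, Finset.mem_filter, mem_flats] at hP
      have := hP.1.1.natRk_closure_insert hi hP.1.2
      rw [hP.2] at this
      rw [this, show M.natRank - (M.natRk P + 1) = M.natRank - 1 - M.natRk P by omega]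
    · intro P hP
      rw [Finset.mem_filter, mem_flats] at hP
      rw [Finset.mem_filter, mem_flats, not_not]
      exact ⟨M.isFlat_closure _, hP.1.insert_subset_closure hi (Set.mem_insert _ _)⟩
  rw [h1, h2]
  ring

theorem reducedCharPoly_eq [M.Loopless] (hi : i ∈ M.E) :
    M.reducedCharPoly = M.avoidingPoly i := by
  rw [reducedCharPoly, M.charPoly_eq_mul_avoidingPoly hi, C_1, ← C_1,
    mul_divByMonic_cancel_left _ (monic_X_sub_C 1)]

open Classical in
/-- The sum of the absolute values of the Möbius function over the flats of rank `k` avoiding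
a point. -/
noncomputable def avoidingSum (i : α) (k : ℕ) : ℤ :=
  ∑ F ∈ (M.flatsIn M.E k).filter (fun F => i ∉ F), M.flatWeight F

theorem avoidingSum_nonneg [M.Loopless] (i : α) (k : ℕ) : 0 ≤ M.avoidingSum i k := by
  classical
  refine Finset.sum_nonneg fun F hF => (M.flatWeight_pos ?_).le
  rw [Finset.mem_filter, mem_flatsIn] at hF
  exact hF.1.1

theorem cast_avoidingSum (i : α) (k : ℕ) :
    (M.avoidingSum i k : ℝ) = ∑ F ∈ M.flatsIn M.E k, (M.flatWeight F : ℝ) * avoids i F := by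
  classical
  rw [avoidingSum, Finset.sum_filter]
  push_cast
  refine Finset.sum_congr rfl fun F _ => ?_
  by_cases hF : i ∈ F
  · simp [avoids_of_mem hF, hF]
  · simp [avoids_of_notMem hF, hF]

/-- Double counting of the pairs P ⊂ F with i ∈ F \ P, weighted by w(P): for fixed F they sum to
w(F), and each P missing `i` has one such F. -/
theorem sum_flatWeight_mem [M.Loopless] (hi : i ∈ M.E) (k : ℕ) :
    ∑ F ∈ M.flatsIn M.E (k + 1), (M.flatWeight F : ℝ) * (1 - avoids i F)
      = M.avoidingSum i k := by
  rw [cast_avoidingSum]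
  have h1 : ∀ F ∈ M.flatsIn M.E (k + 1), (M.flatWeight F : ℝ) * (1 - avoids i F)
      = ∑ P ∈ M.flatsIn M.E k, flatInc P F * M.flatWeight P * (avoids i P - avoids i F) := by
    intro F hF
    rw [mem_flatsIn] at hF
    rw [hF.1.sum_flatWeight_mul_avoids hF.2.2 hF.2.1, mul_comm]
  rw [Finset.sum_congr rfl h1, Finset.sum_comm]
  refine Finset.sum_congr rfl fun P hP => ?_
  rw [mem_flatsIn] at hP
  conv_rhs => rw [← hP.1.sum_flatInc_mul_avoids hP.2.2 M.ground_isFlat hP.2.1 hi, Finset.mul_sum]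
  exact Finset.sum_congr rfl fun F _ => by ring

/-- `FlatInequality` in ranks k + 1 and k + 2, evaluated at the indicator of containing `i`. The two
diagonal sums are a_k and a_{k+1}, and the cross term is a_{k+1}, so the form equals a_k; the linear
term is a_{k+1}. -/
theorem avoidingSum_logConcave [M.Loopless] (hi : i ∈ M.E) (hk : k + 3 ≤ M.natRank) :
    M.avoidingSum i k * M.avoidingSum i (k + 2) ≤ M.avoidingSum i (k + 1) ^ 2 := by
  have key := M.ground_isFlat.flatInequality hi (k := k + 1) (by rw [natRk_ground]; omega)
    (fun F => 1 - avoids i F) (fun F => 1 - avoids i F)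
  have hsq : ∀ F : Set α, (1 - avoids i F) ^ 2 = 1 - avoids i F := by
    intro F
    by_cases hF : i ∈ F
    · rw [avoids_of_mem hF]; norm_num
    · rw [avoids_of_notMem hF]; norm_num
  have hcross : ∑ F ∈ M.flatsIn M.E (k + 1), ∑ H ∈ M.flatsIn M.E (k + 1 + 1),
      flatInc F H * M.flatWeight F * (1 - avoids i F - (1 - avoids i H)) ^ 2
      = (M.avoidingSum i (k + 1) : ℝ) := by
    rw [cast_avoidingSum]
    refine Finset.sum_congr rfl fun F hF => ?_
    rw [mem_flatsIn] at hF
    conv_rhs => rw [← hF.1.sum_flatInc_mul_avoids hF.2.2 M.ground_isFlat hF.2.1 hi, Finset.mul_sum]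
    refine Finset.sum_congr rfl fun H _ => ?_
    by_cases hFH : F ⊆ H
    · have : (1 - avoids i F - (1 - avoids i H)) ^ 2 = avoids i F - avoids i H := by
        by_cases hiF : i ∈ F
        · rw [avoids_of_mem hiF, avoids_of_mem (hFH hiF)]; norm_num
        · by_cases hiH : i ∈ H
          · rw [avoids_of_notMem hiF, avoids_of_mem hiH]; norm_num
          · rw [avoids_of_notMem hiF, avoids_of_notMem hiH]; norm_num
      rw [this]; ring
    · rw [flatInc_of_not_subset hFH]; ring
  simp only [hsq] at key
  rw [hcross, M.sum_flatWeight_mem hi, M.sum_flatWeight_mem hi, ← cast_avoidingSum] at key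
  have h2 : (M.avoidingSum i k : ℝ) * M.avoidingSum i (k + 2)
      ≤ (M.avoidingSum i (k + 1) : ℝ) ^ 2 := by
    have e : k + 1 + 1 = k + 2 := rfl
    rw [e] at key
    linarith
  exact_mod_cast h2

theorem coeff_avoidingPoly (hi : i ∈ M.E) (hk : k + 1 ≤ M.natRank) :
    (M.avoidingPoly i).coeff (M.natRank - 1 - k) = (-1) ^ k * M.avoidingSum i k := by
  classical
  rw [avoidingPoly, finsetSum_coeff, avoidingSum, Finset.mul_sum]
  have hset : (M.flatsIn M.E k).filter (fun F => i ∉ F)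
      = (M.flats.filter (fun F => i ∉ F)).filter (fun F => M.natRk F = k) := by
    ext F
    simp only [Finset.mem_filter, mem_flats, mem_flatsIn]
    exact ⟨fun h => ⟨⟨h.1.1, h.2⟩, h.1.2.2⟩,
      fun h => ⟨⟨h.1.1, h.1.1.subset_ground, h.2⟩, h.1.2⟩⟩
  rw [hset, Finset.sum_filter _ (fun F => (-1) ^ k * M.flatWeight F)]
  refine Finset.sum_congr rfl fun F hF => ?_
  rw [Finset.mem_filter, mem_flats] at hF
  have hlt := hF.1.natRk_lt_natRank hi hF.2
  rw [← C_eq_intCast, coeff_C_mul, coeff_X_pow]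
  split_ifs with h1 h2 h2
  · rw [flatMoebius_eq, h2, mul_one]; rfl
  · omega
  · omega
  · rw [mul_zero]

theorem natDegree_avoidingPoly_le (i : α) : (M.avoidingPoly i).natDegree ≤ M.natRank - 1 := by
  classical
  refine natDegree_sum_le_of_forall_le _ _ fun F _ => ?_
  rw [← C_eq_intCast]
  exact (natDegree_C_mul_X_pow_le _ _).trans (Nat.sub_le _ _)

theorem hasLogConcave_reducedCharPoly_of_loopless [M.Loopless] (h : 1 ≤ M.natRank) :
    M.charPoly = (X - 1) * M.reducedCharPoly ∧
      HasLogConcaveAlternatingCoeffs M.reducedCharPoly (M.natRank - 1) := by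
  obtain ⟨i, hi⟩ := M.exists_mem_ground h
  rw [M.reducedCharPoly_eq hi]
  have hc : ∀ j, j ≤ M.natRank - 1 →
      alternatingCoeff (M.avoidingPoly i) (M.natRank - 1) j = M.avoidingSum i j := by
    intro j hj
    rw [alternatingCoeff, M.coeff_avoidingPoly hi (by omega), ← mul_assoc, ← mul_pow]
    norm_num
  refine ⟨M.charPoly_eq_mul_avoidingPoly hi, M.natDegree_avoidingPoly_le i, ?_, ?_⟩
  · intro j hj
    rw [hc j hj]
    exact M.avoidingSum_nonneg i j
  · intro j h1 hj
    obtain ⟨k, rfl⟩ : ∃ k, j = k + 1 := ⟨j - 1, by omega⟩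
    rw [hc _ (by omega), hc _ (by omega), hc _ (by omega)]
    exact M.avoidingSum_logConcave hi (by omega)

end Matroid

theorem hasLogConcaveAlternatingCoeffs_zero (d : ℕ) : HasLogConcaveAlternatingCoeffs 0 d := by
  refine ⟨by simp, fun i _ => by simp [alternatingCoeff], fun i _ _ => by simp [alternatingCoeff]⟩

theorem Matroid.hasLogConcave_reducedCharPoly {α : Type*} (M : Matroid α) [M.Finite]
    (h : 1 ≤ M.natRank) : M.charPoly = (X - 1) * M.reducedCharPoly ∧
      HasLogConcaveAlternatingCoeffs M.reducedCharPoly (M.natRank - 1) := by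
  by_cases hl : M.Loopless
  · exact M.hasLogConcave_reducedCharPoly_of_loopless h
  · have h0 : M.reducedCharPoly = 0 := by
      rw [reducedCharPoly, M.charPoly_of_not_loopless hl, zero_divByMonic]
    rw [h0, M.charPoly_of_not_loopless hl]
    exact ⟨by simp, hasLogConcaveAlternatingCoeffs_zero _⟩

/-! ### Adding a coloop -/

namespace Matroid

theorem loopless_iff_indep_singleton {α : Type*} {M : Matroid α} :
    M.Loopless ↔ ∀ e ∈ M.E, M.Indep {e} := by
  rw [loopless_iff_forall_isNonloop]
  simp only [indep_singleton]

variable {α : Type*} (M : Matroid α) {F : Set α}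

/-- The sum of a matroid with a coloop. -/
abbrev addColoop : Matroid (α ⊕ Unit) := M.sum uniformOneOne

theorem uniformOneOne_isBasis_iff {I X : Set Unit} : uniformOneOne.IsBasis I X ↔ I = X := by
  rw [uniformOneOne, freeOn_isBasis_iff]
  simp

theorem addColoop_isBasis_image {I X : Set α} :
    M.addColoop.IsBasis (Sum.inl '' I) (Sum.inl '' X) ↔ M.IsBasis I X := by
  rw [addColoop, sum_isBasis_iff, Set.preimage_image_eq _ Sum.inl_injective,
    Set.preimage_image_eq _ Sum.inl_injective, Set.preimage_inr_image_inl,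
    Set.preimage_inr_image_inl, uniformOneOne_isBasis_iff]
  simp

theorem addColoop_isFlat_image : M.addColoop.IsFlat (Sum.inl '' F) ↔ M.IsFlat F := by
  constructor
  · intro h
    refine ⟨fun I X hI hX => ?_, ?_⟩
    · have := h.subset_of_isBasis_of_isBasis (M.addColoop_isBasis_image.2 hI)
        (M.addColoop_isBasis_image.2 hX)
      exact (Set.image_subset_image_iff Sum.inl_injective).1 this
    · intro x hx
      have := h.subset_ground (Set.mem_image_of_mem _ hx)
      simpa [addColoop] using this
  · intro h
    refine ⟨fun I X hI hX => ?_, ?_⟩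
    · rw [addColoop, sum_isBasis_iff, uniformOneOne_isBasis_iff] at hI hX
      rw [Set.preimage_image_eq _ Sum.inl_injective, Set.preimage_inr_image_inl] at hI
      have h1 := h.subset_of_isBasis_of_isBasis hI.1 hX.1
      have h2 := hX.2.symm.trans hI.2
      rintro (x | x) hx
      · exact Set.mem_image_of_mem _ (h1 hx)
      · exact absurd (show x ∈ Sum.inr ⁻¹' X from hx) (by rw [h2]; exact id)
    · rintro _ ⟨x, hx, rfl⟩
      simpa [addColoop] using h.subset_ground hx

theorem addColoop_loopless_iff : M.addColoop.Loopless ↔ M.Loopless := by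
  rw [loopless_iff_indep_singleton, loopless_iff_indep_singleton]
  have h1 : ∀ e : α, M.addColoop.Indep {Sum.inl e} ↔ M.Indep {e} := by
    intro e
    rw [addColoop, sum_indep_iff, ← Set.image_singleton,
      Set.preimage_image_eq _ Sum.inl_injective, Set.preimage_inr_image_inl]
    simp
  have h2 : ∀ e : Unit, M.addColoop.Indep {Sum.inr e} := by
    intro e
    rw [addColoop, sum_indep_iff, ← Set.image_singleton,
      Set.preimage_image_eq _ Sum.inr_injective, Set.preimage_inl_image_inr]
    simp [uniformOneOne]
  constructor
  · exact fun h e he => (h1 e).1 (h _ (by simpa [addColoop] using he))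
  · rintro h (e | e) he
    · exact (h1 e).2 (h e (by simpa [addColoop] using he))
    · exact h2 e

theorem addColoop_natRk_image (hF : F ⊆ M.E) : M.addColoop.natRk (Sum.inl '' F) = M.natRk F := by
  obtain ⟨I, hI⟩ := M.exists_isBasis F hF
  rw [natRk, natRk, hI.eRk_eq_encard, (M.addColoop_isBasis_image.2 hI).eRk_eq_encard,
    Sum.inl_injective.encard_image]

variable [M.Finite]

theorem addColoop_natRank : M.addColoop.natRank = M.natRank + 1 := by
  obtain ⟨B, hB⟩ := M.exists_isBase
  have hN : M.addColoop.IsBase (Sum.inl '' B ∪ {Sum.inr ()}) := by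
    rw [addColoop, sum_isBase_iff]
    constructor
    · convert hB
      ext x; simp
    · rw [uniformOneOne, freeOn_isBase_iff]
      ext x; simp
  have hfin : B.Finite := M.ground_finite.subset hB.subset_ground
  have h4 : M.natRank = B.ncard := by rw [natRank, ← hB.encard_eq_eRank]; rfl
  have h5 : M.addColoop.natRank = (Sum.inl '' B ∪ {Sum.inr ()} : Set (α ⊕ Unit)).ncard := by
    rw [natRank, ← hN.encard_eq_eRank]; rfl
  rw [h4, h5, Set.ncard_union_eq (by simp) (hfin.image _),
    Set.ncard_image_of_injective _ Sum.inl_injective, Set.ncard_singleton]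

open Classical in
theorem flatMoebius_eq_neg_sum (hF : F ≠ ∅) :
    M.flatMoebius F = -∑ P ∈ M.flats.filter (fun P => P ⊂ F), M.flatMoebius P := by
  rw [flatMoebius, if_neg hF, Finset.sum_attach _ (fun P => M.flatMoebius P)]

/-- The flats below the image of `F` are the images of the flats below `F`, so both values satisfy
the same recursion. -/
theorem addColoop_flatMoebius_image (hF : M.IsFlat F) :
    M.addColoop.flatMoebius (Sum.inl '' F) = M.flatMoebius F := by
  classical
  induction hn : F.ncard using Nat.strong_induction_on generalizing F with
  | _ n ih =>
  subst hn
  by_cases h0 : F = ∅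
  · subst h0
    rw [Set.image_empty, flatMoebius_empty, flatMoebius_empty]
  rw [flatMoebius_eq_neg_sum _ h0, flatMoebius_eq_neg_sum _ (by simpa using h0)]
  have hss : ∀ P : Set α, Sum.inl (β := Unit) '' P ⊂ Sum.inl '' F ↔ P ⊂ F := fun P => by
    simp only [ssubset_iff_subset_not_subset, Set.image_subset_image_iff Sum.inl_injective]
  have hset : M.addColoop.flats.filter (fun P => P ⊂ Sum.inl '' F)
      = (M.flats.filter (fun P => P ⊂ F)).image (fun P => Sum.inl '' P) := by
    ext P
    simp only [Finset.mem_filter, mem_flats, Finset.mem_image]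
    constructor
    · rintro ⟨h1, h2⟩
      obtain ⟨P, -, rfl⟩ := Set.subset_image_iff.1 h2.subset
      exact ⟨P, ⟨M.addColoop_isFlat_image.1 h1, (hss P).1 h2⟩, rfl⟩
    · rintro ⟨P, ⟨h1, h2⟩, rfl⟩
      exact ⟨M.addColoop_isFlat_image.2 h1, (hss P).2 h2⟩
  rw [hset, Finset.sum_image (fun P _ Q _ h => Sum.inl_injective.image_injective h)]
  refine congrArg Neg.neg (Finset.sum_congr rfl fun P hP => ?_)
  rw [Finset.mem_filter, mem_flats] at hP
  exact ih _ (Set.ncard_lt_ncard hP.2 (M.ground_finite.subset hF.subset_ground)) hP.1 rfl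

/-- The reduced characteristic polynomial of the sum with a coloop is the characteristic
polynomial. -/
theorem reducedCharPoly_sum_uniformOneOne :
    (M.sum uniformOneOne).reducedCharPoly = M.charPoly := by
  classical
  change M.addColoop.reducedCharPoly = M.charPoly
  by_cases hl : M.Loopless
  · have hl' := M.addColoop_loopless_iff.2 hl
    have hi : Sum.inr () ∈ M.addColoop.E := by simp [addColoop, uniformOneOne]
    rw [reducedCharPoly_eq _ hi, charPoly_eq_sum, avoidingPoly, addColoop_natRank,
      Nat.add_sub_cancel]
    -- With the coloop as distinguished point, the avoiding flats are exactly the flats of `M`, and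
    -- `avoidingPoly` becomes the Möbius expansion of `M.charPoly`.
    have hset : M.addColoop.flats.filter (fun F => Sum.inr () ∉ F)
        = M.flats.image (fun P => Sum.inl '' P) := by
      ext P
      simp only [Finset.mem_filter, mem_flats, Finset.mem_image]
      constructor
      · rintro ⟨h1, h2⟩
        have hP : P ⊆ Sum.inl '' (Set.univ : Set α) := by
          rintro (x | x) hx
          · exact Set.mem_image_of_mem _ (Set.mem_univ x)
          · exact absurd hx h2
        obtain ⟨P, -, rfl⟩ := Set.subset_image_iff.1 hP
        exact ⟨P, M.addColoop_isFlat_image.1 h1, rfl⟩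
      · rintro ⟨P, h1, rfl⟩
        exact ⟨M.addColoop_isFlat_image.2 h1, by simp⟩
    rw [hset, Finset.sum_image (fun P _ Q _ h => Sum.inl_injective.image_injective h)]
    refine Finset.sum_congr rfl fun P hP => ?_
    rw [mem_flats] at hP
    rw [M.addColoop_flatMoebius_image hP, M.addColoop_natRk_image hP.subset_ground]
  · have hl' := fun h => hl (M.addColoop_loopless_iff.1 h)
    rw [reducedCharPoly, charPoly_of_not_loopless _ hl', charPoly_of_not_loopless _ hl,
      zero_divByMonic]

/-- The reduced statement for `M` plus a coloop, whose rank is one larger. -/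
theorem hasLogConcave_charPoly : HasLogConcaveAlternatingCoeffs M.charPoly M.natRank := by
  have h := (M.addColoop.hasLogConcave_reducedCharPoly (by rw [addColoop_natRank]; omega)).2
  have e : M.addColoop.reducedCharPoly = M.charPoly := M.reducedCharPoly_sum_uniformOneOne
  rwa [addColoop_natRank, Nat.add_sub_cancel, e] at h

end Matroid

/-! ### Matroids of finite families of vectors -/

section LinearMatroid

variable {K W E : Type*} [Field K] [AddCommGroup W] [Module K W]

theorem LinearIndepOn.finrank_span_image {v : E → W} {I : Set E} (hI : LinearIndepOn K v I)
    (hfin : I.Finite) : Module.finrank K (Submodule.span K (v '' I)) = I.ncard := by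
  have := hfin.fintype
  rw [Set.image_eq_range, finrank_span_eq_card hI, ← Nat.card_eq_fintype_card,
    Nat.card_coe_set_eq]

/-- The matroid of linear independence of a finite family of vectors. -/
noncomputable def Matroid.ofVectors (K : Type*) [Field K] [Module K W] (v : E → W) {S : Set E}
    (hS : S.Finite) : Matroid E :=
  (IndepMatroid.ofFinite hS (fun I => I ⊆ S ∧ LinearIndepOn K v I)
    ⟨Set.empty_subset _, linearIndepOn_empty K v⟩
    (fun _ _ hJ hIJ => ⟨hIJ.trans hJ.1, hJ.2.mono hIJ⟩)
    (by
      intro I J hI hJ hlt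
      by_contra! hc
      -- If no element of J extends I, all of J lies in the span of I, against the comparison of
      -- dimensions.
      have hle : Submodule.span K (v '' J) ≤ Submodule.span K (v '' I) := by
        rw [Submodule.span_le]
        rintro _ ⟨e, he, rfl⟩
        by_contra hspan
        have heI : e ∉ I := fun h => hspan (Submodule.subset_span (Set.mem_image_of_mem _ h))
        exact hc e he heI (Set.insert_subset (hJ.1 he) hI.1) (hI.2.insert hspan)
      have hfI := hS.subset hI.1
      have : FiniteDimensional K (Submodule.span K (v '' I)) :=
        FiniteDimensional.span_of_finite K (hfI.image v)
      have h1 := Submodule.finrank_mono hle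
      rw [hI.2.finrank_span_image hfI, hJ.2.finrank_span_image (hS.subset hJ.1)] at h1
      omega)
    (fun _ hI => hI.1)).matroid

namespace Matroid

variable {v : E → W} {S : Set E} {hS : S.Finite} {F I X : Set E}

@[simp] theorem ofVectors_indep : (ofVectors K v hS).Indep I ↔ I ⊆ S ∧ LinearIndepOn K v I :=
  Iff.rfl

instance ofVectors_finite : (ofVectors K v hS).Finite := ⟨hS⟩

theorem span_image_of_isBasis_ofVectors (h : (ofVectors K v hS).IsBasis I X) :
    Submodule.span K (v '' X) = Submodule.span K (v '' I) := by
  refine le_antisymm ?_ (Submodule.span_mono (Set.image_mono h.subset))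
  rw [Submodule.span_le]
  rintro _ ⟨e, he, rfl⟩
  by_contra hspan
  have hI := (ofVectors_indep (hS := hS)).1 h.indep
  have hi : (ofVectors K v hS).Indep (insert e I) :=
    ⟨Set.insert_subset (h.subset_ground he) hI.1, hI.2.insert hspan⟩
  have heq := h.eq_of_subset_indep hi (Set.subset_insert _ _) (Set.insert_subset he h.subset)
  have heI : e ∈ I := by rw [heq]; exact Set.mem_insert _ _
  exact hspan (Submodule.subset_span (Set.mem_image_of_mem _ heI))

theorem natRk_ofVectors (hF : F ⊆ S) :
    (ofVectors K v hS).natRk F = Module.finrank K (Submodule.span K (v '' F)) := by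
  obtain ⟨I, hI⟩ := (ofVectors K v hS).exists_isBasis F hF
  have hind := (ofVectors_indep (hS := hS)).1 hI.indep
  rw [span_image_of_isBasis_ofVectors hI, hind.2.finrank_span_image (hS.subset hind.1), natRk,
    hI.eRk_eq_encard]
  rfl

/-- The elements of a family of vectors on which a linear functional vanishes form a flat. -/
theorem isFlat_ofVectors_ker (φ : Module.Dual K W) :
    (ofVectors K v hS).IsFlat {e | e ∈ S ∧ φ (v e) = 0} := by
  refine ⟨fun I X hI hX e he => ⟨hX.subset_ground he, ?_⟩, fun e he => he.1⟩
  have h1 : v e ∈ Submodule.span K (v '' {e | e ∈ S ∧ φ (v e) = 0}) := by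
    rw [span_image_of_isBasis_ofVectors hI, ← span_image_of_isBasis_ofVectors hX]
    exact Submodule.subset_span (Set.mem_image_of_mem _ he)
  have h2 : Submodule.span K (v '' {e | e ∈ S ∧ φ (v e) = 0}) ≤ LinearMap.ker φ := by
    rw [Submodule.span_le]
    rintro _ ⟨e, he, rfl⟩
    exact he.2
  exact h2 h1

theorem loopless_ofVectors : (ofVectors K v hS).Loopless ↔ ∀ e ∈ S, v e ≠ 0 := by
  rw [loopless_iff_indep_singleton]
  refine forall₂_congr fun e he => ?_
  rw [ofVectors_indep, linearIndepOn_singleton_iff, Set.singleton_subset_iff]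
  exact ⟨fun h => h.2, fun h => ⟨he, h⟩⟩

end Matroid

end LinearMatroid

/-! ### Graphic matroids and proper colorings -/

section Coloring

variable {V E : Type*} [Fintype V] [DecidableEq V] (s t : E → V) {S : Set E} (hS : S.Finite)

/-- The vector of an edge of an oriented multigraph. -/
def edgeVector (e : E) : V → ℚ := Pi.single (s e) 1 - Pi.single (t e) 1

/-- The graphic matroid of a finite multigraph, given by the ends of its edges. -/
noncomputable def graphicMatroid : Matroid E := Matroid.ofVectors ℚ (edgeVector s t) hS

instance graphicMatroid_finite : (graphicMatroid s t hS).Finite := Matroid.ofVectors_finite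

/-- The relation of being joined by an edge of `F`. -/
def edgeRel (F : Set E) (x y : V) : Prop := ∃ e ∈ F, s e = x ∧ t e = y

/-- Colorings that are constant on the edges of `F` are functions on the set of components. -/
def coloringEquiv (A : Type*) (F : Set E) :
    {c : V → A // ∀ e ∈ F, c (s e) = c (t e)} ≃ (Quot (edgeRel s t F) → A) where
  toFun c := Quot.lift c.1 (by rintro _ _ ⟨e, he, rfl, rfl⟩; exact c.2 e he)
  invFun g := ⟨fun x => g (Quot.mk _ x), fun e he => congrArg g (Quot.sound ⟨e, he, rfl, rfl⟩)⟩
  left_inv _ := rfl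
  right_inv g := by
    funext x
    induction x using Quot.ind
    rfl

/-- The functionals killing the edge vectors of `F` are the functions on `V` constant along the
edges of `F`, that is, functions on the components. So the annihilator of the span has dimension the
number of components. -/
theorem natRk_graphicMatroid_add {F : Set E} (hF : F ⊆ S) :
    (graphicMatroid s t hS).natRk F + Nat.card (Quot (edgeRel s t F)) = Fintype.card V := by
  classical
  rw [graphicMatroid, Matroid.natRk_ofVectors hF]
  have : Fintype (Quot (edgeRel s t F)) := Fintype.ofFinite _
  set U := Submodule.span ℚ (edgeVector s t '' F)
  -- `f g` is the functional whose value on the basis vector of x is `g` at the component of x.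
  let f : (Quot (edgeRel s t F) → ℚ) →ₗ[ℚ] Module.Dual ℚ (V → ℚ) :=
    (LinearMap.lsum ℚ (fun _ : V => ℚ) ℚ).toLinearMap ∘ₗ
      LinearMap.pi fun x => (LinearMap.toSpanSingleton ℚ (ℚ →ₗ[ℚ] ℚ) LinearMap.id) ∘ₗ
        LinearMap.proj (Quot.mk _ x)
  have hf : ∀ g x, f g (Pi.single x 1) = g (Quot.mk _ x) := by
    intro g x
    simp [f, LinearMap.lsum_apply, Pi.single_apply, LinearMap.sum_apply]
  have hinj : Function.Injective f := by
    intro g g' h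
    funext x
    induction x using Quot.ind with
    | mk x => rw [← hf g x, ← hf g' x, h]
  have hrange : LinearMap.range f = U.dualAnnihilator := by
    ext φ
    rw [LinearMap.mem_range, Submodule.mem_dualAnnihilator]
    constructor
    · rintro ⟨g, rfl⟩ w hw
      have hle : U ≤ LinearMap.ker (f g) := by
        rw [Submodule.span_le]
        rintro _ ⟨e, he, rfl⟩
        rw [SetLike.mem_coe, LinearMap.mem_ker, edgeVector, map_sub, hf, hf, sub_eq_zero]
        exact congrArg g (Quot.sound ⟨e, he, rfl, rfl⟩)
      exact hle hw
    · intro h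
      have hφ : ∀ e ∈ F, φ (Pi.single (s e) 1) = φ (Pi.single (t e) 1) := by
        intro e he
        have := h _ (Submodule.subset_span (Set.mem_image_of_mem (edgeVector s t) he))
        rwa [edgeVector, map_sub, sub_eq_zero] at this
      refine ⟨coloringEquiv s t ℚ F ⟨fun x => φ (Pi.single x 1), hφ⟩, ?_⟩
      refine LinearMap.pi_ext' fun x => LinearMap.ext_ring ?_
      simp only [LinearMap.comp_apply, LinearMap.single_apply]
      rw [hf]
      rfl
  have h1 := Subspace.finrank_add_finrank_dualAnnihilator_eq U
  rw [← hrange, LinearMap.finrank_range_of_inj hinj, Module.finrank_fintype_fun_eq_card,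
    Module.finrank_fintype_fun_eq_card] at h1
  rw [Nat.card_eq_fintype_card]
  exact h1

/-- The number of colorings that are constant on the edges of `F`. -/
theorem card_coloring {F : Set E} (hF : F ⊆ S) (q : ℕ) :
    Nat.card {c : V → Fin q // ∀ e ∈ F, c (s e) = c (t e)}
      = q ^ (Fintype.card V - (graphicMatroid s t hS).natRk F) := by
  rw [Nat.card_congr (coloringEquiv s t (Fin q) F), Nat.card_fun, Nat.card_eq_fintype_card,
    Fintype.card_fin, ← natRk_graphicMatroid_add s t hS hF]
  congr 1
  omega

theorem natRank_graphicMatroid_le : (graphicMatroid s t hS).natRank ≤ Fintype.card V := by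
  rw [← Matroid.natRk_ground, ← natRk_graphicMatroid_add s t hS (F := S) subset_rfl]
  exact Nat.le_add_right _ _

/-- Reading colors as distinct rational numbers makes a coloring a linear functional, which kills an
edge vector exactly when the edge is monochromatic. -/
theorem isFlat_monochromatic {q : ℕ} (c : V → Fin q) :
    (graphicMatroid s t hS).IsFlat {e | e ∈ S ∧ c (s e) = c (t e)} := by
  let φ : Module.Dual ℚ (V → ℚ) := ∑ x, ((c x : ℕ) : ℚ) • LinearMap.proj x
  have hφ : ∀ x, φ (Pi.single x 1) = ((c x : ℕ) : ℚ) := by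
    intro x
    simp [φ, LinearMap.sum_apply, Pi.single_apply]
  have heq : {e | e ∈ S ∧ c (s e) = c (t e)} = {e | e ∈ S ∧ φ (edgeVector s t e) = 0} :=
    Set.ext fun e => and_congr_right fun _ => by
      rw [edgeVector, map_sub, hφ, hφ, sub_eq_zero, Nat.cast_inj, Fin.val_inj]
  rw [heq]
  exact Matroid.isFlat_ofVectors_ker (v := edgeVector s t) (hS := hS) φ

/-- The number of proper colorings is a value of the characteristic polynomial of the graphic
matroid, up to a power of the number of colors. -/
theorem card_properColoring (q : ℕ) :
    (Nat.card {c : V → Fin q // ∀ e ∈ S, c (s e) ≠ c (t e)} : ℤ) =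
      (X ^ (Fintype.card V - (graphicMatroid s t hS).natRank) *
        (graphicMatroid s t hS).charPoly).eval (q : ℤ) := by
  classical
  set M := graphicMatroid s t hS
  by_cases hl : M.Loopless
  -- Sort the colorings by their set of monochromatic edges, which is a flat. Those whose flat
  -- contains F number q^(|V| − rk F), and Möbius inversion at ∅ counts the proper ones.
  · let col : Set E → Finset (V → Fin q) := fun F =>
      Finset.univ.filter fun c => {e | e ∈ S ∧ c (s e) = c (t e)} = F
    have h := M.eq_sum_flatMoebius_mul (fun F => ((col F).card : ℤ))
      (fun F => (q : ℤ) ^ (Fintype.card V - M.natRk F)) (by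
        intro F hF
        rw [Matroid.mem_flats] at hF
        have h1 := card_coloring s t hS hF.subset_ground q
        rw [Nat.card_eq_fintype_card, Fintype.card_subtype] at h1
        rw [← Nat.cast_pow, ← h1, ← Nat.cast_sum]
        congr 1
        rw [← Finset.card_biUnion]
        · congr 1
          ext c
          simp only [col, Finset.mem_biUnion, Finset.mem_filter, Matroid.mem_flats,
            Finset.mem_univ, true_and]
          constructor
          · rintro ⟨G, ⟨-, hFG⟩, rfl⟩ e he
            exact (hFG he).2
          · intro hc
            exact ⟨_, ⟨isFlat_monochromatic s t hS c,
              fun e he => ⟨hF.subset_ground he, hc e he⟩⟩, rfl⟩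
        · intro G _ G' _ hne
          rw [Function.onFun, Finset.disjoint_left]
          intro c hc hc'
          simp only [col, Finset.mem_filter] at hc hc'
          exact hne (hc.2.symm.trans hc'.2))
    have h0 : Nat.card {c : V → Fin q // ∀ e ∈ S, c (s e) ≠ c (t e)} = (col ∅).card := by
      rw [Nat.card_eq_fintype_card, Fintype.card_subtype]
      congr 1
      ext c
      simp only [col, Finset.mem_filter, Finset.mem_univ, true_and, Set.eq_empty_iff_forall_notMem,
        Set.mem_ofPred_eq, not_and]
    rw [h0, h, M.charPoly_eq_sum, eval_mul, eval_finsetSum, Finset.mul_sum]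
    refine Finset.sum_congr rfl fun F _ => ?_
    have h1 := M.natRk_le_natRank F
    have h2 : M.natRank ≤ Fintype.card V := natRank_graphicMatroid_le s t hS
    rw [show Fintype.card V - M.natRk F = (Fintype.card V - M.natRank) + (M.natRank - M.natRk F)
      by omega, pow_add]
    simp only [eval_mul, eval_pow, eval_X, eval_intCast, Int.cast_id]
    ring
  · rw [M.charPoly_of_not_loopless hl, mul_zero, eval_zero]
    have h1 : ¬ ∀ e ∈ S, edgeVector s t e ≠ 0 := fun h => hl (Matroid.loopless_ofVectors.2 h)
    push Not at h1
    obtain ⟨e, he, he0⟩ := h1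
    -- A zero edge vector is a graph loop, and a graph with a loop has no proper coloring.
    have hst : s e = t e := by
      by_contra hne
      have := congrFun he0 (s e)
      simp [edgeVector, hne] at this
    have : IsEmpty {c : V → Fin q // ∀ e ∈ S, c (s e) ≠ c (t e)} :=
      ⟨fun c => c.2 e he (by rw [hst])⟩
    simp

end Coloring

/-- Multiplication by a power of `X` appends zeros to the end of the coefficient sequence, so no
internal zero is created. -/
theorem HasLogConcaveAlternatingCoeffs.X_pow_mul {p : ℤ[X]} {d : ℕ}
    (h : HasLogConcaveAlternatingCoeffs p d) (m : ℕ) :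
    HasLogConcaveAlternatingCoeffs (X ^ m * p) (m + d) := by
  have h1 : ∀ i, i ≤ d → alternatingCoeff (X ^ m * p) (m + d) i = alternatingCoeff p d i := by
    intro i hi
    rw [alternatingCoeff, alternatingCoeff, show m + d - i = (d - i) + m by omega,
      coeff_X_pow_mul]
  have h2 : ∀ i, d < i → i ≤ m + d → alternatingCoeff (X ^ m * p) (m + d) i = 0 := by
    intro i hi hi'
    rw [alternatingCoeff, coeff_X_pow_mul', if_neg (by omega), mul_zero]
  refine ⟨natDegree_mul_le.trans (by rw [natDegree_X_pow]; exact Nat.add_le_add_left h.1 m), ?_, ?_⟩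
  · intro i hi
    rcases le_or_gt i d with hd | hd
    · rw [h1 i hd]; exact h.2.1 i hd
    · rw [h2 i hd hi]
  · intro i hi hid
    rcases le_or_gt (i + 1) d with hd | hd
    · rw [h1 _ (by omega), h1 _ hd, h1 _ (by omega)]
      exact h.2.2 i hi hd
    · rw [h2 _ hd hid, mul_zero]
      exact sq_nonneg _

/-! ### The chromatic polynomial -/

namespace Graph

variable {V E : Type*} (G : Graph V E)

theorem exists_isChromaticPolynomial (hV : G.vertexSet.Finite) (hE : G.edgeSet.Finite) :
    ∃ p, G.IsChromaticPolynomial p ∧ HasLogConcaveAlternatingCoeffs p G.vertexSet.ncard := by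
  classical
  have := hV.fintype
  -- The end maps are defined on all of `E`, so elements outside `edgeSet` need a default vertex,
  -- supplied by an edge. Without edges the vertex set may be empty, and the polynomial is the power
  -- `X ^ n` directly.
  by_cases he : G.edgeSet.Nonempty
  · obtain ⟨e0, he0⟩ := he
    have hends : ∀ e, ∃ x : G.vertexSet × G.vertexSet, e ∈ G.edgeSet → G.IsLink e x.1 x.2 := by
      intro e
      by_cases h : e ∈ G.edgeSet
      · obtain ⟨x, y, hxy⟩ := exists_isLink_of_mem_edgeSet h
        exact ⟨(⟨x, hxy.left_mem⟩, ⟨y, hxy.right_mem⟩), fun _ => hxy⟩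
      · obtain ⟨x, y, hxy⟩ := exists_isLink_of_mem_edgeSet he0
        exact ⟨(⟨x, hxy.left_mem⟩, ⟨x, hxy.left_mem⟩), fun h' => absurd h' h⟩
    choose f hf using hends
    set M := graphicMatroid (fun e => (f e).1) (fun e => (f e).2) hE
    have hcard : Fintype.card G.vertexSet = G.vertexSet.ncard := by
      rw [← Nat.card_eq_fintype_card, Nat.card_coe_set_eq]
    have hr : M.natRank ≤ Fintype.card G.vertexSet := natRank_graphicMatroid_le _ _ hE
    refine ⟨X ^ (Fintype.card G.vertexSet - M.natRank) * M.charPoly, ?_, ?_⟩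
    · intro q _
      rw [← card_properColoring (fun e => (f e).1) (fun e => (f e).2) hE q, numProperColorings]
      congr 1
      refine Nat.card_congr (Equiv.subtypeEquivRight fun c => ⟨fun h e x y hxy => ?_,
        fun h e he => h e _ _ (hf e he)⟩)
      have h1 := h e hxy.edge_mem
      rcases (hf e hxy.edge_mem).eq_and_eq_or_eq_and_eq hxy with ⟨e1, e2⟩ | ⟨e1, e2⟩
      · rwa [Subtype.ext e1, Subtype.ext e2] at h1
      · rw [Subtype.ext e1, Subtype.ext e2] at h1
        exact h1.symm
    · have := M.hasLogConcave_charPoly.X_pow_mul (Fintype.card G.vertexSet - M.natRank)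
      rw [Nat.sub_add_cancel hr] at this
      rw [← hcard]
      exact this
  · refine ⟨X ^ G.vertexSet.ncard, ?_, ?_⟩
    · intro q _
      rw [eval_pow, eval_X, numProperColorings, ← Nat.card_coe_set_eq, ← Nat.cast_pow]
      congr 1
      have : {c : G.vertexSet → Fin q // ∀ (e : E) (x y : G.vertexSet),
          G.IsLink e x y → c x ≠ c y} ≃ (G.vertexSet → Fin q) :=
        Equiv.subtypeUnivEquiv fun c e x y h => absurd ⟨e, h.edge_mem⟩ he
      rw [Nat.card_congr this, Nat.card_fun, Nat.card_eq_fintype_card (α := Fin q),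
        Fintype.card_fin]
    · have h1 : HasLogConcaveAlternatingCoeffs 1 0 :=
        ⟨by simp, fun i hi => by
          obtain rfl : i = 0 := by omega
          simp [alternatingCoeff], fun i hi hi' => by omega⟩
      have := h1.X_pow_mul G.vertexSet.ncard
      rwa [mul_one, add_zero] at this

theorem IsChromaticPolynomial.unique {G : Graph V E} {p p' : ℤ[X]} (h : G.IsChromaticPolynomial p)
    (h' : G.IsChromaticPolynomial p') : p = p' := by
  refine eq_of_infinite_eval_eq p p' ?_
  refine ((Set.Ici_infinite (1 : ℕ)).image Nat.cast_injective.injOn).mono ?_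
  rintro _ ⟨q, hq, rfl⟩
  exact (h q hq).trans (h' q hq).symm

end Graph

theorem theoremt :
    (∀ (α : Type*) (M : Matroid α) [M.Finite],
      HasLogConcaveAlternatingCoeffs M.charPoly M.natRank ∧
      (1 ≤ M.natRank →
        M.charPoly = (X - 1) * M.reducedCharPoly ∧
        HasLogConcaveAlternatingCoeffs M.reducedCharPoly (M.natRank - 1)) ∧
      (M.sum Matroid.uniformOneOne).reducedCharPoly = M.charPoly) ∧
    (∀ (V E : Type*) (G : Graph V E), G.vertexSet.Finite → G.edgeSet.Finite →
      (∃! p : ℤ[X], G.IsChromaticPolynomial p) ∧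
      ∀ p : ℤ[X], G.IsChromaticPolynomial p →
        HasLogConcaveAlternatingCoeffs p G.vertexSet.ncard) := by
  refine ⟨fun α M _ => ⟨M.hasLogConcave_charPoly, M.hasLogConcave_reducedCharPoly,
    M.reducedCharPoly_sum_uniformOneOne⟩, fun V E G hV hE => ?_⟩
  obtain ⟨p, hp, hlc⟩ := G.exists_isChromaticPolynomial hV hE
  refine ⟨⟨p, hp, fun p' hp' => hp'.unique hp⟩, fun p' hp' => ?_⟩
  rw [hp'.unique hp]
  exact hlc
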